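/- For integers $n\ge 1$ and $r\ge 2$ with $r\mid 2n$, let $K_{r\times 2n/r}$ be the complete $r$-partite graph with all parts of size $2n/r$, let $\mathrm{pm}(G)$ be the number of perfect matchings of a graph $G$, and let $G-M$ be $G$ with the edges of $M$ deleted. For integer-valued random variables $X,Y$ let $\mathrm{d}_{\mathrm{TV}}(X,Y)=\frac12\sum_{k\in\mathbb Z}|\Pr(X=k)-\Pr(Y=k)|$, and let $\mathrm{Po}(\lambda)$ be the Poisson distribution with parameter $\lambda$. Let $r=r(n)\ge 2$ be integer valued with $r(n)\mid 2n$, and let $M_n$ be any sequence of perfect matchings of $K_{r\times 2n/r}$. Let $R_n$ be a uniformly random perfect matching of $K_{r\times 2n/r}$, and let $X=X(M_n)$ be the number of edges shared by $M_n$ and $R_n$. Then, as $n\to\infty$, $$\mathrm{d}_{\mathrm{TV}}\left(X,\mathrm{Po}\left(\frac{r}{2r-2}\right)\right)\to 0 \qquad\text{and}\qquad \frac{\mathrm{pm}(K_{r\times 2n/r}-M_n)}{\mathrm{pm}(K_{r\times 2n/r})}\sim e^{-r/(2r-2)}.$$ Both hold uniformly: for every $\varepsilon>0$ there is $N$ such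 that for all $n\ge N$, all $r\ge2$ dividing $2n$, and all perfect matchings $M$ of $K_{r\times 2n/r}$, we have $\mathrm{d}_{\mathrm{TV}}\left(X(M),\mathrm{Po}\left(\frac{r}{2r-2}\right)\right)<\varepsilon$ and $\left|\frac{\mathrm{pm}(K_{r\times 2n/r}-M)}{\mathrm{pm}(K_{r\times 2n/r})}\,e^{r/(2r-2)}-1\right|<\varepsilon$. (The statement about the ratio is the Johnston–Kayll–Palmer conjecture.) -/

import Mathlib

open Filter Topology

/-- The perfect matchings of a graph `G` (as spanning subgraphs that are matchings). -/
abbrev PerfectMatching {V : Type*} (G : SimpleGraph V) : Type _ :=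
  {P : G.Subgraph // P.IsPerfectMatching}

/-- `pm(G)`, the number of perfect matchings of `G`. -/
noncomputable def pm {V : Type*} (G : SimpleGraph V) : ℕ :=
  Nat.card (PerfectMatching G)

/-- The number of edges shared by two perfect matchings of `G`. -/
noncomputable def sharedEdges {V : Type*} {G : SimpleGraph V} (M P : PerfectMatching G) : ℕ :=
  (M.1.edgeSet ∩ P.1.edgeSet).ncard

/-- The uniform distribution on the perfect matchings of a finite graph `G`
(which has at least one, namely `M`). -/
noncomputable def uniformMatching {V : Type*} [Finite V] {G : SimpleGraph V}
    (M : PerfectMatching G) : PMF (PerfectMatching G) :=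
  haveI : Fintype (PerfectMatching G) := Fintype.ofFinite _
  haveI : Nonempty (PerfectMatching G) := ⟨M⟩
  PMF.uniformOfFintype (PerfectMatching G)

/-- The law of `X(M)`, the number of edges that `M` shares with a uniformly random perfect
matching of `G`, as a measure on `ℕ`. -/
noncomputable def sharedLaw {V : Type*} [Finite V] {G : SimpleGraph V}
    (M : PerfectMatching G) : MeasureTheory.Measure ℕ :=
  ((uniformMatching M).map (sharedEdges M)).toMeasure

/-- Total variation distance `(1/2) ∑ₖ |μ(k) - ν(k)|` between two probability laws on `ℕ`. -/
noncomputable def tvDist (μ ν : MeasureTheory.Measure ℕ) : ℝ :=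
  (1 / 2) * ∑' k : ℕ, |μ.real {k} - ν.real {k}|

/-- The complete `r`-partite graph `K_{r × 2n/r}` with all parts of size `2n/r`. -/
abbrev balancedMultipartite (r n : ℕ) : SimpleGraph (Fin r × Fin (2 * n / r)) :=
  SimpleGraph.completeEquipartiteGraph r (2 * n / r)

/-- The number `r / (2r - 2)`. -/
noncomputable def rate (r : ℕ) : ℝ := (r : ℝ) / (2 * (r : ℝ) - 2)

/-- The total variation distance between `X(M)` and `Po(r / (2r - 2))`,
for a perfect matching `M` of `K_{r × 2n/r}`. -/
noncomputable def poissonError {r n : ℕ} (M : PerfectMatching (balancedMultipartite r n)) : ℝ :=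
  tvDist (sharedLaw M) (ProbabilityTheory.poissonMeasure (rate r).toNNReal)

/-- The ratio `pm(G - M) / pm(G)`, where `G - M` is `G` with the edges of `M` deleted. -/
noncomputable def derangedRatio {V : Type*} {G : SimpleGraph V} (M : PerfectMatching G) : ℝ :=
  (pm (G.deleteEdges M.1.edgeSet) : ℝ) / (pm G : ℝ)

/-! A uniformly random perfect matching of the multipartite graph is studied through switchings: the
edges {a, σ a} and {c, σ c} are replaced by {a, c} and {σ a, σ c}. Each switch can be undone by
another, so double counting the pairs (σ, c) (`sum_switch`) compares the sizes of families of
matchings.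

Let N = r * m = 2n, and let μ be the fixed matching. A given pair is an edge of σ with probability
O(1/N). The central claim is that, for each vertex a, the event that σ contains the μ-edge at a and
has j + 2 agreeing vertices is nearly 1/((r - 1) m) times as likely as the event that σ has j
agreeing vertices. Summing over a, and using that agreements are twice the common edges, gives
approximately (k + 1) p (k + 1) = λ p k with λ = r / (2r - 2), the recursion of the Poisson
probabilities. With a Markov bound on the tail, this approximate recursion forces p to be close to
Poisson in total variation, and p 0 is the ratio in the conjecture.

The central claim has two regimes. With many parts, almost every one of about (r - 1) m vertices c
is available for a switch at a, and the relative error is O(1/r)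
(`abs_card_partner_sub_le_of_parts`). With boundedly many parts, hence large ones, switching only
inside the part of μ a gives an exact factor m, and it remains to show that the part of σ a is
nearly uniform over the other r - 1 parts, jointly with the number of agreements
(`abs_card_part_sub_card_part_le`). The number of switches taking the partner of a from part B to
part C is m minus the number of B–C edges. That factor is divided out by a weight which such
switches preserve; it is bounded unless most of B is matched to C, which a second-moment estimate
(`sum_crossCount_sub_sq_le`) shows to be unlikely. -/

section Switching

/-! ### Switchings of perfect matchings and their effect on agreements -/

variable {V ι : Type*} [Fintype V] [DecidableEq V] [DecidableEq ι]

/-- The involutions of `V` that move every vertex to a different part; these encode the perfect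
matchings of the complete multipartite graph with parts the fibres of `π`. -/
def partInvolutions (π : V → ι) : Finset (Equiv.Perm V) :=
  Finset.univ.filter fun σ => (∀ v, σ (σ v) = v) ∧ ∀ v, π (σ v) ≠ π v

/-- Conjugation by a transposition, which exchanges the partners of `x` and `y`. -/
def conjSwap (x y : V) (σ : Equiv.Perm V) : Equiv.Perm V :=
  Equiv.swap x y * σ * Equiv.swap x y

/-- The partner of `a` may be replaced by `c` by exchanging the partners of `σ a` and `c`. -/
def Switchable (π : V → ι) (a : V) (σ : Equiv.Perm V) (c : V) : Prop :=
  π c ≠ π a ∧ π (σ c) ≠ π (σ a)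

instance (π : V → ι) (a : V) (σ : Equiv.Perm V) : DecidablePred (Switchable π a σ) :=
  fun _ => inferInstanceAs (Decidable (_ ∧ _))

theorem mem_partInvolutions {π : V → ι} {σ : Equiv.Perm V} :
    σ ∈ partInvolutions π ↔ (∀ v, σ (σ v) = v) ∧ ∀ v, π (σ v) ≠ π v := by
  simp [partInvolutions]

variable {π : V → ι} {σ : Equiv.Perm V} {a c : V}

/-- Switchability rules out c = a and σ c = σ a, leaving four distinct vertices or the trivial
switch c = σ a, which fixes σ and is allowed throughout. -/
theorem conjSwap_apply (hσ : σ ∈ partInvolutions π) (h : Switchable π a σ c) (v : V) :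
    conjSwap (σ a) c σ v = if v = a then c else if v = c then a else if v = σ a then σ c
      else if v = σ c then σ a else σ v := by
  obtain ⟨h1, h2⟩ := mem_partInvolutions.1 hσ
  obtain ⟨h3, h4⟩ := h
  have := h1 a
  have := h1 c
  have := h1 v
  have := h2 a
  have := h2 c
  have := h2 v
  simp only [conjSwap, Equiv.Perm.mul_apply, Equiv.swap_apply_def]
  grind

theorem conjSwap_mem (hσ : σ ∈ partInvolutions π) (h : Switchable π a σ c) :
    conjSwap (σ a) c σ ∈ partInvolutions π := by
  have key := conjSwap_apply hσ h
  obtain ⟨h1, h2⟩ := mem_partInvolutions.1 hσ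
  obtain ⟨h3, h4⟩ := h
  refine mem_partInvolutions.2 ⟨fun v => ?_, fun v => ?_⟩
  · simp only [conjSwap, Equiv.Perm.mul_apply, Equiv.swap_apply_self, h1]
  · rw [key]
    have := h1 a
    have := h1 c
    have := h2 v
    grind

theorem conjSwap_switchable (hσ : σ ∈ partInvolutions π) (h : Switchable π a σ c) :
    Switchable π a (conjSwap (σ a) c σ) (σ a) := by
  have k1 := conjSwap_apply hσ h a
  have k2 := conjSwap_apply hσ h (σ a)
  obtain ⟨h1, h2⟩ := mem_partInvolutions.1 hσ
  obtain ⟨h3, h4⟩ := h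
  have := h2 a
  have := h2 c
  have := h1 a
  refine ⟨h2 a, ?_⟩
  rw [k1, k2]
  grind

theorem conjSwap_conjSwap (hσ : σ ∈ partInvolutions π) (h : Switchable π a σ c) :
    conjSwap (conjSwap (σ a) c σ a) (σ a) (conjSwap (σ a) c σ) = σ := by
  have k1 := conjSwap_apply hσ h a
  rw [if_pos rfl] at k1
  rw [k1]
  ext v
  simp [conjSwap, Equiv.swap_comm c (σ a)]

/-- Switching at `a` is an involution on the pairs `(σ, c)` with `c` switchable. -/
theorem sum_switch (π : V → ι) (a : V) (G : Equiv.Perm V → V → ℝ) :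
    ∑ σ ∈ partInvolutions π, ∑ c with Switchable π a σ c, G σ c =
      ∑ σ ∈ partInvolutions π, ∑ c with Switchable π a σ c, G (conjSwap (σ a) c σ) (σ a) := by
  rw [Finset.sum_sigma', Finset.sum_sigma']
  have key : ∀ p : (_ : Equiv.Perm V) × V, p ∈ (partInvolutions π).sigma
      (fun σ => Finset.univ.filter (Switchable π a σ)) →
      p.1 ∈ partInvolutions π ∧ Switchable π a p.1 p.2 := by
    intro p hp
    simpa using hp
  refine Finset.sum_nbij' (fun p => ⟨conjSwap (p.1 a) p.2 p.1, p.1 a⟩)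
    (fun p => ⟨conjSwap (p.1 a) p.2 p.1, p.1 a⟩) ?_ ?_ ?_ ?_ ?_
  · intro p hp
    obtain ⟨h1, h2⟩ := key p hp
    simpa using ⟨conjSwap_mem h1 h2, conjSwap_switchable h1 h2⟩
  · intro p hp
    obtain ⟨h1, h2⟩ := key p hp
    simpa using ⟨conjSwap_mem h1 h2, conjSwap_switchable h1 h2⟩
  · rintro ⟨σ, c⟩ hp
    obtain ⟨h1, h2⟩ := key _ hp
    have := conjSwap_apply h1 h2 a
    simp only [conjSwap_conjSwap h1 h2]
    simp_all
  · rintro ⟨σ, c⟩ hp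
    obtain ⟨h1, h2⟩ := key _ hp
    have := conjSwap_apply h1 h2 a
    simp only [conjSwap_conjSwap h1 h2]
    simp_all
  · rintro ⟨σ, c⟩ hp
    obtain ⟨h1, h2⟩ := key _ hp
    have := conjSwap_apply h1 h2 a
    simp only [conjSwap_conjSwap h1 h2]
    simp_all

/-- The number of vertices at which `μ` and `σ` agree. -/
def agreements (μ σ : Equiv.Perm V) : ℕ := (Finset.univ.filter fun v => σ v = μ v).card

/-- The two removed edges are not in μ because σ a ≠ μ a. Of the two added edges, the one at a is in
μ, and the other is not by `h2`; so exactly the vertices a and μ a are gained. -/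
theorem agreements_conjSwap_partner {μ : Equiv.Perm V} (hμ : μ ∈ partInvolutions π)
    (hσ : σ ∈ partInvolutions π) (h : Switchable π a σ (μ a)) (h1 : σ a ≠ μ a)
    (h2 : σ a ≠ μ (σ (μ a))) :
    agreements μ (conjSwap (σ a) (μ a) σ) = agreements μ σ + 2 := by
  have key := conjSwap_apply hσ h
  obtain ⟨m1, m2⟩ := mem_partInvolutions.1 hμ
  obtain ⟨s1, s2⟩ := mem_partInvolutions.1 hσ
  have : (Finset.univ.filter fun v => conjSwap (σ a) (μ a) σ v = μ v) =
      insert a (insert (μ a) (Finset.univ.filter fun v => σ v = μ v)) := by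
    ext v
    simp only [Finset.mem_filter, Finset.mem_univ, true_and, Finset.mem_insert, key]
    have := m1 a
    have := s1 a
    have := s1 (μ a)
    have := m1 (σ (μ a))
    have := m1 (σ a)
    have := m2 a
    grind
  rw [agreements, this, Finset.card_insert_of_notMem, Finset.card_insert_of_notMem]
  · rfl
  · simp only [Finset.mem_filter, Finset.mem_univ, true_and, m1]
    intro h
    apply h1
    rw [← s1 (μ a), h]
  · simp only [Finset.mem_filter, Finset.mem_univ, true_and, Finset.mem_insert, not_or]
    refine ⟨fun h => m2 a (by rw [← h]), h1⟩

/-- The hypotheses say that neither removed edge (`h1`, `h2`) and neither added edge (`h3`, `h4`)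
belongs to μ. -/
theorem agreements_conjSwap {μ : Equiv.Perm V} (hμ : μ ∈ partInvolutions π)
    (hσ : σ ∈ partInvolutions π) (h : Switchable π a σ c) (h1 : σ a ≠ μ a)
    (h2 : σ c ≠ μ c) (h3 : c ≠ μ a) (h4 : σ c ≠ μ (σ a)) :
    agreements μ (conjSwap (σ a) c σ) = agreements μ σ := by
  have key := conjSwap_apply hσ h
  obtain ⟨m1, m2⟩ := mem_partInvolutions.1 hμ
  obtain ⟨s1, s2⟩ := mem_partInvolutions.1 hσ
  rw [agreements, agreements]
  congr 1
  ext v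
  simp only [Finset.mem_filter, Finset.mem_univ, true_and, key]
  have := m1 a
  have := m1 c
  have := s1 a
  have := s1 c
  have := m1 (σ a)
  have := m1 (σ c)
  grind

end Switching

/-! ### Counting switches, and rarity of prescribed partners -/

section Switching

variable {V ι : Type*} [Fintype V] [DecidableEq V] [DecidableEq ι]
variable {π : V → ι} {σ μ : Equiv.Perm V} {m r : ℕ}

omit [DecidableEq V] in
theorem card_part_partner (hm : ∀ i, (Finset.univ.filter fun v => π v = i).card = m)
    (σ : Equiv.Perm V) (i : ι) : (Finset.univ.filter fun v => π (σ v) = i).card = m := by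
  rw [← hm i]
  exact Finset.card_bij (fun v _ => σ v) (by simp) (by simp)
    (fun w hw => ⟨σ.symm w, by simpa using hw, by simp⟩)

theorem le_card_switchable (hm : ∀ i, (Finset.univ.filter fun v => π v = i).card = m)
    (hV : Fintype.card V = r * m) (σ : Equiv.Perm V) (a : V) :
    r * m ≤ (Finset.univ.filter (Switchable π a σ)).card + 2 * m := by
  have h : (Finset.univ : Finset V) ⊆ Finset.univ.filter (Switchable π a σ) ∪
      ((Finset.univ.filter fun v => π v = π a) ∪
        Finset.univ.filter fun v => π (σ v) = π (σ a)) := by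
    intro v _
    simp only [Finset.mem_union, Finset.mem_filter, Finset.mem_univ, true_and, Switchable]
    tauto
  have h1 := Finset.card_le_card h
  rw [Finset.card_univ, hV] at h1
  have h2 := Finset.card_union_le (Finset.univ.filter (Switchable π a σ))
    ((Finset.univ.filter fun v => π v = π a) ∪
        Finset.univ.filter fun v => π (σ v) = π (σ a))
  have h3 := Finset.card_union_le (Finset.univ.filter fun v => π v = π a)
    (Finset.univ.filter fun v => π (σ v) = π (σ a))
  rw [hm, card_part_partner hm] at h3
  lia

/-- Every vertex in the part of σ a can be switched in. This serves r = 2, where the bound of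
`le_card_switchable` is empty. -/
theorem card_part_le_card_switchable
    (hm : ∀ i, (Finset.univ.filter fun v => π v = i).card = m)
    (hσ : σ ∈ partInvolutions π) (a : V) :
    m ≤ (Finset.univ.filter (Switchable π a σ)).card := by
  obtain ⟨h1, h2⟩ := mem_partInvolutions.1 hσ
  rw [← hm (π (σ a))]
  refine Finset.card_le_card fun v hv => ?_
  simp only [Finset.mem_filter, Finset.mem_univ, true_and, Switchable] at hv ⊢
  exact ⟨hv ▸ h2 a, hv ▸ h2 v⟩

theorem le_three_mul_card_switchable
    (hm : ∀ i, (Finset.univ.filter fun v => π v = i).card = m)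
    (hV : Fintype.card V = r * m) (hr : 2 ≤ r) (hσ : σ ∈ partInvolutions π) (a : V) :
    r * m ≤ 3 * (Finset.univ.filter (Switchable π a σ)).card := by
  have h1 := le_card_switchable hm hV σ a
  have h2 := card_part_le_card_switchable hm hσ a
  rcases Nat.lt_or_ge r 3 with h | h
  · have : r = 2 := by lia
    subst this
    lia
  · have : 3 * m ≤ r * m := Nat.mul_le_mul_right m h
    lia

/-- The partner of `a` lies in a small set determined by the partner of `b` with small
probability. -/
theorem card_partner_mem_le (hm : ∀ i, (Finset.univ.filter fun v => π v = i).card = m)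
    (hV : Fintype.card V = r * m) (hr : 2 ≤ r) (hN : 24 ≤ r * m) {a b : V} (hab : a ≠ b)
    (S : V → Finset V) {s : ℕ} (hS : ∀ y, (S y).card ≤ s) :
    ((r * m : ℕ) : ℝ) *
      ((partInvolutions π).filter fun σ => σ a ≠ b ∧ σ a ∈ S (σ b)).card ≤
        4 * s * (partInvolutions π).card := by
  have key := sum_switch π a fun σ c =>
    if (σ a ≠ b ∧ σ a ∈ S (σ b)) ∧ c ≠ b ∧ c ≠ σ b then 1 else 0
  have lower : ((r * m : ℕ) : ℝ) / 4 *
      ((partInvolutions π).filter fun σ => σ a ≠ b ∧ σ a ∈ S (σ b)).card ≤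
      ∑ σ ∈ partInvolutions π, ∑ c with Switchable π a σ c,
        if (σ a ≠ b ∧ σ a ∈ S (σ b)) ∧ c ≠ b ∧ c ≠ σ b then (1 : ℝ) else 0 := by
    rw [Finset.card_filter, Nat.cast_sum, Finset.mul_sum]
    refine Finset.sum_le_sum fun σ hσ => ?_
    by_cases h : σ a ≠ b ∧ σ a ∈ S (σ b)
    · simp only [h, ne_eq, not_false_eq_true, true_and, and_true, if_true, Nat.cast_one, mul_one,
        Finset.sum_boole]
      have h1 := le_three_mul_card_switchable hm hV hr hσ a
      have h2 : (Finset.univ.filter (Switchable π a σ)).card ≤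
          ((Finset.univ.filter (Switchable π a σ)).filter
            fun c => ¬ c = b ∧ ¬ c = σ b).card + 2 := by
        have h3 : Finset.univ.filter (Switchable π a σ) ⊆
            ((Finset.univ.filter (Switchable π a σ)).filter fun c => ¬ c = b ∧ ¬ c = σ b) ∪
              {b, σ b} := by
          intro c hc
          simp only [Finset.mem_union, Finset.mem_filter, Finset.mem_univ, true_and,
            Finset.mem_insert, Finset.mem_singleton] at hc ⊢
          tauto
        exact (Finset.card_le_card h3).trans ((Finset.card_union_le _ _).trans
          (Nat.add_le_add_left Finset.card_le_two _))
      -- A third of r * m, less the two excluded vertices, is still a quarter because r * m ≥ 24.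
      have h4 : r * m ≤ 4 * ((Finset.univ.filter (Switchable π a σ)).filter
            fun c => ¬ c = b ∧ ¬ c = σ b).card := by lia
      have h5 : ((r * m : ℕ) : ℝ) ≤ 4 * (((Finset.univ.filter (Switchable π a σ)).filter
            fun c => ¬ c = b ∧ ¬ c = σ b).card : ℝ) := by exact_mod_cast h4
      linarith
    · rw [if_neg h]
      simp only [Nat.cast_zero, mul_zero]
      exact Finset.sum_nonneg fun c _ => by split_ifs <;> norm_num
  -- The exclusions of b and σ b keep the partner of b unchanged by the switch, so in the reverse
  -- direction c itself must lie in `S (σ b)`, leaving at most s choices.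
  have upper : (∑ σ ∈ partInvolutions π, ∑ c with Switchable π a σ c,
        if (conjSwap (σ a) c σ a ≠ b ∧ conjSwap (σ a) c σ a ∈ S (conjSwap (σ a) c σ b)) ∧
          σ a ≠ b ∧ σ a ≠ conjSwap (σ a) c σ b then (1 : ℝ) else 0) ≤
      s * (partInvolutions π).card := by
    rw [mul_comm, ← nsmul_eq_mul]
    refine Finset.sum_le_card_nsmul _ _ _ fun σ hσ => ?_
    rw [Finset.sum_boole, Nat.cast_le]
    refine (Finset.card_le_card ?_).trans (hS (σ b))
    intro c hc
    simp only [Finset.mem_filter, Finset.mem_univ, true_and] at hc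
    obtain ⟨h1, h2⟩ := hc
    rw [conjSwap_apply hσ h1, conjSwap_apply hσ h1] at h2
    grind
  rw [key] at lower
  linarith [lower.trans upper]

/-- A given vertex is the partner of `a` with small probability. -/
theorem card_partner_eq_le (hm : ∀ i, (Finset.univ.filter fun v => π v = i).card = m)
    (hV : Fintype.card V = r * m) (hr : 2 ≤ r) (hN : 24 ≤ r * m) (a b : V) :
    ((r * m : ℕ) : ℝ) * ((partInvolutions π).filter fun σ => σ a = b).card ≤
        4 * (partInvolutions π).card := by
  -- A dummy vertex x plays the role of b in `card_partner_mem_le`, with the constant set {b}.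
  obtain ⟨x, hx⟩ : ∃ x, x ∉ ({a, b} : Finset V) := by
    by_contra! h
    have h1 : Fintype.card V ≤ ({a, b} : Finset V).card :=
      Finset.card_le_card fun v _ => h v
    have : ({a, b} : Finset V).card ≤ 2 := Finset.card_le_two
    lia
  simp only [Finset.mem_insert, Finset.mem_singleton, not_or] at hx
  have := card_partner_mem_le hm hV hr hN (Ne.symm hx.1) (fun _ => {b}) (s := 1) (by simp)
  simp only [Finset.mem_singleton, Nat.cast_one, mul_one] at this
  convert this using 5
  exact ⟨fun h => ⟨by rw [h]; exact Ne.symm hx.2, h⟩, fun h => h.2⟩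

theorem abs_ite_sub_ite_le (p q : Prop) [Decidable p] [Decidable q] {E : ℝ} (hE : 0 ≤ E)
    (h : (p ↔ q) ∨ 1 ≤ E) : |(if p then (1 : ℝ) else 0) - (if q then 1 else 0)| ≤ E := by
  by_cases hp : p <;> by_cases hq : q <;> simp_all

/-- Comparison of the matchings containing the `μ`-edge at `a` with the matchings from which that
edge can be produced by a switch. -/
theorem abs_sum_partner_sub_le (hm : ∀ i, (Finset.univ.filter fun v => π v = i).card = m)
    (hV : Fintype.card V = r * m) (hr : 2 ≤ r) (hN : 24 ≤ r * m)
    (hμ : μ ∈ partInvolutions π) (a : V) (j : ℕ) (R : V → Prop) [DecidablePred R] :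
    ((r * m : ℕ) : ℝ) * |(∑ σ ∈ partInvolutions π with σ a = μ a ∧ agreements μ σ = j + 2,
        (((Finset.univ.filter (Switchable π a σ)).filter R).card : ℝ)) -
      ((partInvolutions π).filter fun σ =>
        R (σ a) ∧ Switchable π a σ (μ a) ∧ agreements μ σ = j).card| ≤
      8 * (partInvolutions π).card := by
  have key := sum_switch π a fun σ c =>
    if (σ a = μ a ∧ agreements μ σ = j + 2) ∧ R c then 1 else 0
  have e1 : (∑ σ ∈ partInvolutions π, ∑ c with Switchable π a σ c,
      if (σ a = μ a ∧ agreements μ σ = j + 2) ∧ R c then (1 : ℝ) else 0) =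
      ∑ σ ∈ partInvolutions π with σ a = μ a ∧ agreements μ σ = j + 2,
        (((Finset.univ.filter (Switchable π a σ)).filter R).card : ℝ) := by
    rw [Finset.sum_filter]
    refine Finset.sum_congr rfl fun σ _ => ?_
    split_ifs with h
    · simp [h]
    · simp [h]
  -- After the switch the partner of a is c, so only c = μ a contributes.
  have e2 : (∑ σ ∈ partInvolutions π, ∑ c with Switchable π a σ c,
      if (conjSwap (σ a) c σ a = μ a ∧ agreements μ (conjSwap (σ a) c σ) = j + 2) ∧ R (σ a)
        then (1 : ℝ) else 0) =
      ∑ σ ∈ partInvolutions π, if R (σ a) ∧ Switchable π a σ (μ a) ∧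
        agreements μ (conjSwap (σ a) (μ a) σ) = j + 2 then (1 : ℝ) else 0 := by
    refine Finset.sum_congr rfl fun σ hσ => ?_
    rw [Finset.sum_filter, Finset.sum_eq_single (μ a)]
    · by_cases h : Switchable π a σ (μ a)
      · have := conjSwap_apply hσ h a
        rw [if_pos rfl] at this
        simp only [h, this, true_and, if_true]
        simp only [and_comm]
      · simp [h]
    · intro c _ hc
      split_ifs with h1 h2
      · have := conjSwap_apply hσ h1 a
        rw [if_pos rfl] at this
        rw [this] at h2
        exact absurd h2.1.1 hc
      · rfl
      · rfl
    · simp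
  have e3 : (((partInvolutions π).filter fun σ =>
        R (σ a) ∧ Switchable π a σ (μ a) ∧ agreements μ σ = j).card : ℝ) =
      ∑ σ ∈ partInvolutions π,
        if R (σ a) ∧ Switchable π a σ (μ a) ∧ agreements μ σ = j then (1 : ℝ) else 0 := by
    rw [Finset.sum_boole]
  rw [← e1, key, e2, e3, ← Finset.sum_sub_distrib]
  have hne : a ≠ μ a := fun h => (mem_partInvolutions.1 hμ).2 a (by rw [← h])
  have b1 := card_partner_eq_le hm hV hr hN a (μ a)
  have b2 := card_partner_mem_le hm hV hr hN hne (fun y => {μ y}) (s := 1) (by simp)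
  -- The switch to μ a raises the agreements by exactly 2 unless the μ-edge at a is already present
  -- or the second new edge is also in μ. Each exception has probability at most 4 / (r * m), whence
  -- the constant 8.
  have b3 : |∑ σ ∈ partInvolutions π, ((if R (σ a) ∧ Switchable π a σ (μ a) ∧
        agreements μ (conjSwap (σ a) (μ a) σ) = j + 2 then (1 : ℝ) else 0) -
        if R (σ a) ∧ Switchable π a σ (μ a) ∧ agreements μ σ = j then (1 : ℝ) else 0)| ≤
      ((partInvolutions π).filter fun σ => σ a = μ a).card +
      ((partInvolutions π).filter fun σ => σ a ≠ μ a ∧ σ a ∈ ({μ (σ (μ a))} : Finset V)).card := by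
    rw [Finset.card_filter, Finset.card_filter, Nat.cast_sum, Nat.cast_sum,
      ← Finset.sum_add_distrib]
    refine (Finset.abs_sum_le_sum_abs _ _).trans (Finset.sum_le_sum fun σ hσ => ?_)
    refine abs_ite_sub_ite_le _ _ (by positivity) ?_
    by_cases h1 : σ a = μ a
    · right; simp [h1]
    by_cases h2 : σ a = μ (σ (μ a))
    · right; simp [h1, ← h2]
    left
    refine and_congr_right fun _ => and_congr_right fun h3 => ?_
    rw [agreements_conjSwap_partner hμ hσ h3 h1 h2]
    lia
  have b4 := mul_le_mul_of_nonneg_left b3 (Nat.cast_nonneg (α := ℝ) (r * m))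
  simp only [Nat.cast_one, mul_one] at b2
  linarith

end Switching

/-! ### Comparison at one edge: many parts, and edge counts between parts -/

section Switching

variable {V ι : Type*} [Fintype V] [DecidableEq V] [DecidableEq ι]
variable {π : V → ι} {σ μ : Equiv.Perm V} {m r : ℕ}

omit [DecidableEq V] in
theorem card_switchable_le (hm : ∀ i, (Finset.univ.filter fun v => π v = i).card = m)
    (hV : Fintype.card V = r * m) (σ : Equiv.Perm V) (a : V) :
    (Finset.univ.filter (Switchable π a σ)).card + m ≤ r * m := by
  have h := Finset.card_le_card (Finset.monotone_filter_right Finset.univ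
    (p := Switchable π a σ) (q := fun v => ¬ π v = π a) fun v _ hv => hv.1)
  have h2 := Finset.card_filter_add_card_filter_not (s := Finset.univ) (fun v => π v = π a)
  rw [Finset.card_univ, hV, hm] at h2
  lia

/-- Each edge of `μ` is in `σ` nearly independently of the number of agreements,
with an error that is small if there are many parts. -/
theorem abs_card_partner_sub_le_of_parts
    (hm : ∀ i, (Finset.univ.filter fun v => π v = i).card = m)
    (hV : Fintype.card V = r * m) (hr : 2 ≤ r) (hN : 24 ≤ r * m)
    (hμ : μ ∈ partInvolutions π) (a : V) (j : ℕ) :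
    (r : ℝ) * |((r : ℝ) - 1) * m *
        ((partInvolutions π).filter fun σ => σ a = μ a ∧ agreements μ σ = j + 2).card -
      ((partInvolutions π).filter fun σ => agreements μ σ = j).card| ≤
      16 * (partInvolutions π).card := by
  have key := abs_sum_partner_sub_le hm hV hr hN hμ a j (fun _ => True)
  simp only [true_and, Finset.filter_true] at key
  set T : ℝ := ((partInvolutions π).card : ℝ) with hT
  set F := (partInvolutions π).filter fun σ => σ a = μ a ∧ agreements μ σ = j + 2 with hF
  set S := ∑ σ ∈ F, ((Finset.univ.filter (Switchable π a σ)).card : ℝ) with hS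
  have hT0 : 0 ≤ T := Nat.cast_nonneg _
  have hm0 : 1 ≤ m := Nat.pos_of_ne_zero (by rintro rfl; simp at hN)
  have hm1 : (1 : ℝ) ≤ m := by exact_mod_cast hm0
  have hr1 : (2 : ℝ) ≤ r := by exact_mod_cast hr
  have hrm : ((r * m : ℕ) : ℝ) = r * m := by push_cast; ring
  rw [hrm] at key
  have hne : a ≠ μ a := fun h => (mem_partInvolutions.1 hμ).2 a (by rw [← h])
  have f1 : (F.card : ℝ) * (r * m) ≤ 4 * T := by
    have b1 := card_partner_eq_le hm hV hr hN a (μ a)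
    have : F.card ≤ ((partInvolutions π).filter fun σ => σ a = μ a).card :=
      Finset.card_le_card (Finset.monotone_filter_right _ fun v _ hv => hv.1)
    have h2 : (F.card : ℝ) ≤ ((partInvolutions π).filter fun σ => σ a = μ a).card := by
      exact_mod_cast this
    rw [hrm] at b1
    nlinarith [mul_le_mul_of_nonneg_left h2 (by positivity : (0 : ℝ) ≤ r * m)]
  have s1 : S ≤ F.card * ((r - 1) * m) := by
    rw [← nsmul_eq_mul]
    refine Finset.sum_le_card_nsmul _ _ _ fun σ hσ => ?_
    have := card_switchable_le hm hV σ a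
    have : (((Finset.univ.filter (Switchable π a σ)).card + m : ℕ) : ℝ) ≤ (r * m : ℕ) := by
      exact_mod_cast this
    push_cast at this
    linarith
  have s2 : F.card * ((r - 2) * m) ≤ S := by
    rw [← nsmul_eq_mul]
    refine Finset.card_nsmul_le_sum _ _ _ fun σ hσ => ?_
    have := le_card_switchable hm hV σ a
    have : ((r * m : ℕ) : ℝ) ≤ ((Finset.univ.filter (Switchable π a σ)).card + 2 * m : ℕ) := by
      exact_mod_cast this
    push_cast at this
    linarith
  set P := (partInvolutions π).filter fun σ => agreements μ σ = j
  set Q := (partInvolutions π).filter fun σ => Switchable π a σ (μ a) ∧ agreements μ σ = j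
  set W := (partInvolutions π).filter fun σ => σ a ≠ μ a ∧
    σ a ∈ Finset.univ.filter (fun v => π v = π (σ (μ a)))
  have w1 : (r : ℝ) * W.card ≤ 4 * T := by
    have := card_partner_mem_le hm hV hr hN hne
      (fun y => Finset.univ.filter (fun v => π v = π y)) (fun y => (hm _).le)
    rw [hrm] at this
    refine le_of_mul_le_mul_right ?_ (by linarith : (0 : ℝ) < m)
    calc (r : ℝ) * W.card * m = r * m * W.card := by ring
      _ ≤ 4 * m * T := this
      _ = 4 * T * m := by ring
  have p1 : Q.card ≤ P.card :=
    Finset.card_le_card (Finset.monotone_filter_right _ fun v _ hv => hv.2)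
  -- The vertex μ a fails to be switchable only if σ a and σ (μ a) share a part, an event of
  -- probability at most 4 / r by `w1`.
  have p2 : P.card ≤ Q.card + W.card := by
    refine (Finset.card_le_card ?_).trans (Finset.card_union_le _ _)
    intro σ hσ
    simp only [P, Q, W, Finset.mem_union, Finset.mem_filter, Finset.mem_univ,
      true_and] at hσ ⊢
    have h1 := (mem_partInvolutions.1 hσ.1).1 a
    have h2 := (mem_partInvolutions.1 hμ).2 a
    by_cases h : σ a = μ a
    · left
      refine ⟨hσ.1, ⟨h2, ?_⟩, hσ.2⟩
      rw [← h, h1, h]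
      exact h2.symm
    · by_cases h3 : π (σ a) = π (σ (μ a))
      · exact Or.inr ⟨hσ.1, h, h3⟩
      · exact Or.inl ⟨hσ.1, ⟨h2, Ne.symm h3⟩, hσ.2⟩
  have p1' : (Q.card : ℝ) ≤ P.card := by exact_mod_cast p1
  have p2' : (P.card : ℝ) ≤ Q.card + W.card := by exact_mod_cast p2
  have k1 : (r : ℝ) * |S - Q.card| ≤ 8 * T := by
    refine le_trans ?_ key
    refine mul_le_mul_of_nonneg_right ?_ (abs_nonneg _)
    nlinarith
  have hr0 : (0 : ℝ) ≤ r := by linarith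
  -- After multiplication by r the three terms are at most 4 T, 8 T and 4 T: the uncertainty in the
  -- number of switches, the switching error, and the failures of switchability.
  have tri : |((r : ℝ) - 1) * m * F.card - P.card| ≤
      (F.card * m) + |S - Q.card| + W.card := by
    have h1 := abs_le.1 (le_refl |S - Q.card|)
    rw [abs_le]
    constructor <;> nlinarith
  have := mul_le_mul_of_nonneg_left tri hr0
  nlinarith

/-- Restricting switches to the part of μ a makes both counts exact: if σ a = μ a, all m vertices of
that part are switchable, and if σ a merely lies in that part, then μ a is automatically switchable.
-/
theorem abs_card_partner_sub_card_part_le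
    (hm : ∀ i, (Finset.univ.filter fun v => π v = i).card = m)
    (hV : Fintype.card V = r * m) (hr : 2 ≤ r) (hN : 24 ≤ r * m)
    (hμ : μ ∈ partInvolutions π) (a : V) (j : ℕ) :
    ((r * m : ℕ) : ℝ) * |(m : ℝ) *
        ((partInvolutions π).filter fun σ => σ a = μ a ∧ agreements μ σ = j + 2).card -
      ((partInvolutions π).filter fun σ => π (σ a) = π (μ a) ∧ agreements μ σ = j).card| ≤
      8 * (partInvolutions π).card := by
  have key := abs_sum_partner_sub_le hm hV hr hN hμ a j (fun v => π v = π (μ a))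
  have hμa := (mem_partInvolutions.1 hμ).2 a
  have e1 : (∑ σ ∈ partInvolutions π with σ a = μ a ∧ agreements μ σ = j + 2,
        (((Finset.univ.filter (Switchable π a σ)).filter fun v => π v = π (μ a)).card : ℝ)) =
      m * ((partInvolutions π).filter fun σ => σ a = μ a ∧ agreements μ σ = j + 2).card := by
    rw [mul_comm, ← nsmul_eq_mul]
    refine Finset.sum_eq_card_nsmul fun σ hσ => ?_
    rw [Finset.mem_filter] at hσ
    rw [Nat.cast_inj, ← hm (π (μ a))]
    congr 1
    ext v
    simp only [Finset.mem_filter, Finset.mem_univ, true_and, Switchable, and_iff_right_iff_imp]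
    intro hv
    have := (mem_partInvolutions.1 hσ.1).2 v
    rw [hσ.2.1, ← hv]
    exact ⟨hv ▸ hμa, this⟩
  have e2 : ((partInvolutions π).filter fun σ =>
        π (σ a) = π (μ a) ∧ Switchable π a σ (μ a) ∧ agreements μ σ = j) =
      (partInvolutions π).filter fun σ => π (σ a) = π (μ a) ∧ agreements μ σ = j := by
    refine Finset.filter_congr fun σ hσ => and_congr_right fun h => ?_
    simp only [Switchable, and_iff_right_iff_imp]
    intro _
    refine ⟨hμa, ?_⟩
    rw [h]
    exact (mem_partInvolutions.1 hσ).2 _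
  rw [e1, e2] at key
  exact key

/-- The number of vertices in part `B` whose partner is in part `C`. -/
def crossCount (π : V → ι) (σ : Equiv.Perm V) (B C : ι) : ℕ :=
  (Finset.univ.filter fun v => π v = B ∧ π (σ v) = C).card

theorem crossCount_comm (hσ : σ ∈ partInvolutions π) (B C : ι) :
    crossCount π σ B C = crossCount π σ C B := by
  have h := (mem_partInvolutions.1 hσ).1
  refine Finset.card_bij' (fun v _ => σ v) (fun v _ => σ v) ?_ ?_ ?_ ?_ <;> simp [h] <;> tauto

theorem crossCount_add_le (hm : ∀ i, (Finset.univ.filter fun v => π v = i).card = m)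
    {A B C : ι} (hBC : B ≠ C) : crossCount π σ A B + crossCount π σ A C ≤ m := by
  rw [← hm A, crossCount, crossCount, ← Finset.card_union_of_disjoint]
  · refine Finset.card_le_card fun v hv => ?_
    simp only [Finset.mem_union, Finset.mem_filter, Finset.mem_univ, true_and] at hv ⊢
    tauto
  · rw [Finset.disjoint_filter]
    rintro v _ ⟨_, h⟩ ⟨_, h'⟩
    exact hBC (h.symm.trans h')

omit [DecidableEq V] in
theorem crossCount_le (hm : ∀ i, (Finset.univ.filter fun v => π v = i).card = m)
    (A B : ι) : crossCount π σ A B ≤ m := by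
  rw [← hm A, crossCount]
  exact Finset.card_le_card (Finset.monotone_filter_right _ fun v _ hv => hv.1)

/-- Within part C, the only obstruction to switching is a partner lying in the part B of σ a. -/
theorem card_switchable_part (hm : ∀ i, (Finset.univ.filter fun v => π v = i).card = m)
    {a : V} {B C : ι} (hC : C ≠ π a) (hB : π (σ a) = B) :
    (((Finset.univ.filter (Switchable π a σ)).filter fun c => π c = C).card : ℝ) =
      m - crossCount π σ C B := by
  rw [eq_sub_iff_add_eq, ← hm C, ← Nat.cast_add, Nat.cast_inj, crossCount,
    ← Finset.card_union_of_disjoint]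
  · congr 1
    ext v
    simp only [Finset.mem_union, Finset.mem_filter, Finset.mem_univ, true_and, Switchable, hB]
    constructor
    · tauto
    · intro hv
      by_cases h : π (σ v) = B
      · exact Or.inr ⟨hv, h⟩
      · exact Or.inl ⟨⟨hv ▸ hC, h⟩, hv⟩
  · rw [Finset.disjoint_left]
    intro v
    simp only [Finset.mem_filter, Finset.mem_univ, true_and, Switchable, hB]
    tauto

/-- Moving the partner of `a` from part `B` to part `C`. -/
theorem sum_switch_part (hm : ∀ i, (Finset.univ.filter fun v => π v = i).card = m)
    {a : V} {B C : ι} (hC : C ≠ π a) (f : Equiv.Perm V → ℝ) :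
    ∑ σ ∈ partInvolutions π with π (σ a) = B, (m - crossCount π σ C B) * f σ =
      ∑ σ ∈ partInvolutions π with π (σ a) = C,
        ∑ c ∈ (Finset.univ.filter (Switchable π a σ)).filter fun c => π c = B,
          f (conjSwap (σ a) c σ) := by
  have key := sum_switch π a fun σ c => if π (σ a) = B ∧ π c = C then f σ else 0
  have e1 : (∑ σ ∈ partInvolutions π, ∑ c with Switchable π a σ c,
      if π (σ a) = B ∧ π c = C then f σ else 0) =
      ∑ σ ∈ partInvolutions π with π (σ a) = B, (m - crossCount π σ C B) * f σ := by
    rw [Finset.sum_filter]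
    refine Finset.sum_congr rfl fun σ _ => ?_
    split_ifs with h
    · simp only [h, true_and]
      rw [← Finset.sum_filter, Finset.sum_const, nsmul_eq_mul, card_switchable_part hm hC h]
    · simp [h]
  rw [← e1, key, Finset.sum_filter]
  refine Finset.sum_congr rfl fun σ hσ => ?_
  split_ifs with h
  · symm
    rw [Finset.sum_filter]
    refine Finset.sum_congr rfl fun c hc => ?_
    have := conjSwap_apply hσ (Finset.mem_filter.1 hc).2 a
    rw [if_pos rfl] at this
    simp [this, h]
  · exact Finset.sum_eq_zero fun c _ => by simp [h]

end Switching

/-! ### Large parts: second moments of edge counts, and uniformity of the partner's part -/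

section Switching

variable {V ι : Type*} [Fintype V] [DecidableEq V] [DecidableEq ι]
variable {π : V → ι} {σ μ : Equiv.Perm V} {m r : ℕ}

/-- In the part of a, only a and possibly σ c get a new partner: σ a and c lie outside that part. -/
theorem abs_crossCount_conjSwap_sub_le (hσ : σ ∈ partInvolutions π) {a c : V}
    (h : Switchable π a σ c) (X : ι) :
    |(crossCount π (conjSwap (σ a) c σ) (π a) X : ℝ) - crossCount π σ (π a) X| ≤ 2 := by
  have key := conjSwap_apply hσ h
  have h2 := (mem_partInvolutions.1 hσ).2 a
  have aux : ∀ s t : Finset V, s ⊆ t ∪ {a, σ c} → (s.card : ℝ) ≤ t.card + 2 := by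
    intro s t hst
    exact_mod_cast (Finset.card_le_card hst).trans ((Finset.card_union_le _ _).trans
      (Nat.add_le_add_left Finset.card_le_two _))
  have hc := h.1
  have h4 : ∀ v, π v = π a → v ≠ a → v ≠ σ c → conjSwap (σ a) c σ v = σ v := by
    intro v h5 h6 h7
    rw [key, if_neg h6, if_neg, if_neg, if_neg h7]
    · rintro rfl; exact h2 h5
    · rintro rfl; exact hc h5
  rw [abs_le]
  constructor
  · have := aux (Finset.univ.filter fun v => π v = π a ∧ π (σ v) = X)
      (Finset.univ.filter fun v => π v = π a ∧ π (conjSwap (σ a) c σ v) = X) (by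
        intro v hv
        simp only [Finset.mem_union, Finset.mem_filter, Finset.mem_univ, true_and,
          Finset.mem_insert, Finset.mem_singleton] at hv ⊢
        by_cases h6 : v = a
        · exact Or.inr (Or.inl h6)
        by_cases h7 : v = σ c
        · exact Or.inr (Or.inr h7)
        rw [h4 v hv.1 h6 h7]
        exact Or.inl hv)
    rw [crossCount, crossCount]
    linarith
  · have := aux (Finset.univ.filter fun v => π v = π a ∧ π (conjSwap (σ a) c σ v) = X)
      (Finset.univ.filter fun v => π v = π a ∧ π (σ v) = X) (by
        intro v hv
        simp only [Finset.mem_union, Finset.mem_filter, Finset.mem_univ, true_and,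
          Finset.mem_insert, Finset.mem_singleton] at hv ⊢
        by_cases h6 : v = a
        · exact Or.inr (Or.inl h6)
        by_cases h7 : v = σ c
        · exact Or.inr (Or.inr h7)
        rw [h4 v hv.1 h6 h7] at hv
        exact Or.inl hv)
    rw [crossCount, crossCount]
    linarith

/-- No edge between the parts of σ a and c is created or destroyed: σ c lies in neither part, by
switchability and because its partner is c, and a lies in neither. This exact invariance is what
lets a weight depending on the count pass through a switch. -/
theorem crossCount_conjSwap (hσ : σ ∈ partInvolutions π) {a c : V}
    (h : Switchable π a σ c) (hB : π (σ a) ≠ π c) :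
    crossCount π (conjSwap (σ a) c σ) (π (σ a)) (π c) = crossCount π σ (π (σ a)) (π c) := by
  have key := conjSwap_apply hσ h
  obtain ⟨h1, h2⟩ := mem_partInvolutions.1 hσ
  rw [crossCount, crossCount]
  congr 1
  refine Finset.filter_congr fun v _ => and_congr_right fun hv => ?_
  obtain ⟨h3, h4⟩ := h
  have := h2 a
  have := h2 c
  have := h1 a
  rw [key]
  grind

theorem sum_sum_partner (A B : ι) (f : Equiv.Perm V → ℝ) :
    ∑ a with π a = A, ∑ σ ∈ partInvolutions π with π (σ a) = B, f σ =
      ∑ σ ∈ partInvolutions π, crossCount π σ A B * f σ := by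
  simp_rw [Finset.sum_filter (fun σ : Equiv.Perm V => π (σ _) = B)]
  rw [Finset.sum_comm]
  refine Finset.sum_congr rfl fun σ _ => ?_
  rw [← Finset.sum_filter, Finset.sum_const, nsmul_eq_mul, Finset.filter_filter, crossCount]

/-- The numbers of edges from a part to two other parts are close to each other in mean square,
unless almost all edges at these parts run between them. -/
theorem sum_crossCount_sub_sq_le
    (hm : ∀ i, (Finset.univ.filter fun v => π v = i).card = m)
    {A B C : ι} (hAB : A ≠ B) (hAC : A ≠ C) :
    ∑ σ ∈ partInvolutions π, ((crossCount π σ A B : ℝ) - crossCount π σ A C) ^ 2 *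
      (m - crossCount π σ B C) ≤ 4 * m ^ 2 * (partInvolutions π).card := by
  set φ : Equiv.Perm V → ℝ := fun σ => (crossCount π σ A B : ℝ) - crossCount π σ A C with hφ
  -- Moving one partner from B to C changes each of the two counts in φ by at most 2, hence φ by at
  -- most 4. Subtracting the φ-term on the right leaves φ squared on the left and only the 4 m error
  -- on the right.
  have h1 : ∑ σ ∈ partInvolutions π, (crossCount π σ A B : ℝ) *
      ((m - crossCount π σ C B) * φ σ) ≤
      ∑ σ ∈ partInvolutions π, (crossCount π σ A C : ℝ) *
        ((m - crossCount π σ B C) * φ σ + 4 * m) := by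
    rw [← sum_sum_partner, ← sum_sum_partner]
    refine Finset.sum_le_sum fun a ha => ?_
    have ha' : π a = A := by simpa using ha
    rw [sum_switch_part hm (by rw [ha']; exact hAC.symm)]
    refine Finset.sum_le_sum fun σ hσ => ?_
    rw [Finset.mem_filter] at hσ
    rw [← card_switchable_part hm (by rw [ha']; exact hAB.symm) hσ.2]
    have h2 : (((Finset.univ.filter (Switchable π a σ)).filter fun c => π c = B).card : ℝ) ≤ m := by
      rw [card_switchable_part hm (by rw [ha']; exact hAB.symm) hσ.2]
      have : (0 : ℝ) ≤ crossCount π σ B C := Nat.cast_nonneg _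
      linarith
    calc _ ≤ ∑ c ∈ (Finset.univ.filter (Switchable π a σ)).filter fun c => π c = B,
          (φ σ + 4) := by
          refine Finset.sum_le_sum fun c hc => ?_
          have hc' : Switchable π a σ c := by simp at hc; exact hc.1
          have i1 := abs_le.1 (abs_crossCount_conjSwap_sub_le hσ.1 hc' B)
          have i2 := abs_le.1 (abs_crossCount_conjSwap_sub_le hσ.1 hc' C)
          rw [ha'] at i1 i2
          simp only [hφ]
          linarith
      _ ≤ _ := by
          rw [Finset.sum_const, nsmul_eq_mul]
          linarith
  have h2 : ∑ σ ∈ partInvolutions π, (crossCount π σ A C : ℝ) * (4 * m) ≤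
      4 * m ^ 2 * (partInvolutions π).card := by
    rw [mul_comm _ ((partInvolutions π).card : ℝ), ← nsmul_eq_mul]
    refine Finset.sum_le_card_nsmul _ _ _ fun σ hσ => ?_
    have : (crossCount π σ A C : ℝ) ≤ m := by exact_mod_cast crossCount_le hm A C
    have : (0 : ℝ) ≤ m := Nat.cast_nonneg _
    nlinarith
  refine le_trans (le_of_eq ?_) (le_trans (sub_le_sub_right h1 (∑ σ ∈ partInvolutions π,
    (crossCount π σ A C : ℝ) * ((m - crossCount π σ B C) * φ σ))) (le_trans (le_of_eq ?_) h2))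
  · rw [← Finset.sum_sub_distrib]
    refine Finset.sum_congr rfl fun σ hσ => ?_
    rw [crossCount_comm hσ C B]
    simp only [hφ]
    ring
  · rw [← Finset.sum_sub_distrib]
    refine Finset.sum_congr rfl fun σ hσ => ?_
    ring

/-- If more than 3/4 of C is matched to B, then C has less than m / 4 edges to A, and so has B. The
second-moment inequality centred at C, comparing B with A, then has integrand at least (m / 2)² · (3
m / 4), while its sum is at most 4 m² times the number of matchings; and 64 / 3 ≤ 22. -/
theorem card_crossCount_large_le
    (hm : ∀ i, (Finset.univ.filter fun v => π v = i).card = m) (hm0 : 1 ≤ m)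
    {A B C : ι} (hAB : A ≠ B) (hAC : A ≠ C) (hBC : B ≠ C) :
    (m : ℝ) * ((partInvolutions π).filter fun σ => ¬ 4 * crossCount π σ C B ≤ 3 * m).card ≤
      22 * (partInvolutions π).card := by
  have key := sum_crossCount_sub_sq_le (A := C) (B := B) (C := A) hm hBC.symm hAC.symm
  have hm1 : (1 : ℝ) ≤ m := by exact_mod_cast hm0
  have low : (((partInvolutions π).filter fun σ => ¬ 4 * crossCount π σ C B ≤ 3 * m).card : ℝ) *
      (3 / 16 * m ^ 3) ≤ ∑ σ ∈ partInvolutions π,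
        ((crossCount π σ C B : ℝ) - crossCount π σ C A) ^ 2 * (m - crossCount π σ B A) := by
    rw [Finset.card_filter, Nat.cast_sum, Finset.sum_mul]
    refine Finset.sum_le_sum fun σ hσ => ?_
    have h1 : (crossCount π σ B A : ℝ) + crossCount π σ C B ≤ m := by
      rw [crossCount_comm hσ C B]
      exact_mod_cast crossCount_add_le hm hAC
    have h2 : (crossCount π σ C B : ℝ) + crossCount π σ C A ≤ m := by
      exact_mod_cast crossCount_add_le hm hAB.symm
    have h3 : (0 : ℝ) ≤ crossCount π σ C B := Nat.cast_nonneg _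
    split_ifs with h
    · rw [Nat.cast_zero, zero_mul]
      exact mul_nonneg (sq_nonneg _) (by linarith)
    · have : (3 : ℝ) * m < 4 * crossCount π σ C B := by exact_mod_cast not_le.1 h
      have i1 : (m : ℝ) / 2 ≤ (crossCount π σ C B : ℝ) - crossCount π σ C A := by linarith
      have i2 : 3 / 4 * (m : ℝ) ≤ m - crossCount π σ B A := by linarith
      calc ((1 : ℕ) : ℝ) * (3 / 16 * m ^ 3) = (m / 2) ^ 2 * (3 / 4 * m) := by push_cast; ring
        _ ≤ _ := by gcongr
  have h := low.trans key
  have hT : (0 : ℝ) ≤ (partInvolutions π).card := Nat.cast_nonneg _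
  refine le_of_mul_le_mul_left (a := (3 / 16 * (m : ℝ) ^ 2)) ?_ (by positivity)
  nlinarith [mul_nonneg (sq_nonneg (m : ℝ)) hT]

/-- The part of the partner of `a` is nearly uniform among the other parts, and nearly
independent of the number of agreements, if the parts are large. -/
theorem abs_card_part_sub_card_part_le
    (hm : ∀ i, (Finset.univ.filter fun v => π v = i).card = m)
    (hV : Fintype.card V = r * m) (hr : 2 ≤ r) (hN : 24 ≤ r * m)
    (hμ : μ ∈ partInvolutions π) {a : V} {B C : ι} (hB : B ≠ π a) (hC : C ≠ π a) (j : ℕ) :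
    (m : ℝ) * |(((partInvolutions π).filter fun σ =>
        π (σ a) = B ∧ agreements μ σ = j).card : ℝ) -
      ((partInvolutions π).filter fun σ => π (σ a) = C ∧ agreements μ σ = j).card| ≤
      50 * (partInvolutions π).card := by
  rcases eq_or_ne B C with rfl | hBC
  · simp
  have hm0 : 1 ≤ m := Nat.pos_of_ne_zero (by rintro rfl; simp at hN)
  have hm1 : (1 : ℝ) ≤ m := by exact_mod_cast hm0
  set T : ℝ := ((partInvolutions π).card : ℝ) with hT
  -- The weight cancels the factor m - crossCount in `sum_switch_part`; the truncation at 3/4 keeps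
  -- it at most 4 / m.
  set h : Equiv.Perm V → ℝ := fun σ =>
    if 4 * crossCount π σ C B ≤ 3 * m then ((m : ℝ) - crossCount π σ C B)⁻¹ else 0 with hh
  set f : Equiv.Perm V → ℝ := fun σ => if agreements μ σ = j then h σ else 0 with hf
  have h_good : ∀ σ : Equiv.Perm V, ((m : ℝ) - crossCount π σ C B) * h σ =
      if 4 * crossCount π σ C B ≤ 3 * m then 1 else 0 := by
    intro σ
    simp only [hh]
    split_ifs with hg
    · have : (4 : ℝ) * crossCount π σ C B ≤ 3 * m := by exact_mod_cast hg
      exact mul_inv_cancel₀ (by linarith)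
    · simp
  have h_nonneg : ∀ σ, 0 ≤ h σ := by
    intro σ
    simp only [hh]
    split_ifs with hg
    · have : (4 : ℝ) * crossCount π σ C B ≤ 3 * m := by exact_mod_cast hg
      exact inv_nonneg.2 (by linarith)
    · simp
  have h_le : ∀ σ, h σ ≤ 4 / m := by
    intro σ
    simp only [hh]
    split_ifs with hg
    · have : (4 : ℝ) * crossCount π σ C B ≤ 3 * m := by exact_mod_cast hg
      rw [show (4 : ℝ) / m = (m / 4 : ℝ)⁻¹ by rw [inv_div]]
      exact inv_anti₀ (by linarith) (by linarith)
    · positivity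
  have count : ∀ D : ι, ∑ σ ∈ partInvolutions π with π (σ a) = D,
      ((m : ℝ) - crossCount π σ C B) * f σ = ((partInvolutions π).filter fun σ =>
        (π (σ a) = D ∧ agreements μ σ = j) ∧ 4 * crossCount π σ C B ≤ 3 * m).card := by
    intro D
    rw [← Finset.sum_boole, Finset.sum_filter]
    refine Finset.sum_congr rfl fun σ _ => ?_
    have := h_good σ
    simp only [hf]
    by_cases i1 : π (σ a) = D <;> by_cases i2 : agreements μ σ = j <;> simp [i1, i2, this]
  have key := sum_switch_part hm hC (B := B) f
  have e2 : ∑ σ ∈ partInvolutions π with π (σ a) = C,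
      ((m : ℝ) - crossCount π σ C B) * f σ = ∑ σ ∈ partInvolutions π with π (σ a) = C,
        ∑ c ∈ (Finset.univ.filter (Switchable π a σ)).filter fun c => π c = B, f σ := by
    refine Finset.sum_congr rfl fun σ hσ => ?_
    rw [Finset.mem_filter] at hσ
    rw [Finset.sum_const, nsmul_eq_mul, card_switchable_part hm hB hσ.2,
      crossCount_comm hσ.1 B C]
  -- E counts the exceptions of `agreements_conjSwap`: a removed or added edge lies in μ.
  set E : Equiv.Perm V → V → ℝ := fun σ c => (if σ a = μ a then 1 else 0) +
    (if σ c = μ c then 1 else 0) + (if c = μ a then 1 else 0) +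
    (if σ c = μ (σ a) then 1 else 0) with hE
  have E_nonneg : ∀ σ c, 0 ≤ E σ c := fun σ c => by simp only [hE]; positivity
  have diff : |(∑ σ ∈ partInvolutions π with π (σ a) = B, (m - crossCount π σ C B) * f σ) -
      ∑ σ ∈ partInvolutions π with π (σ a) = C, (m - crossCount π σ C B) * f σ| ≤
      ∑ σ ∈ partInvolutions π, ∑ c with π c = B, 4 / m * E σ c := by
    rw [key, e2, ← Finset.sum_sub_distrib]
    refine (Finset.abs_sum_le_sum_abs _ _).trans ?_
    refine le_trans ?_ (Finset.sum_le_sum_of_subset_of_nonneg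
      (Finset.filter_subset (fun σ : Equiv.Perm V => π (σ a) = C) (partInvolutions π))
      fun σ _ _ => Finset.sum_nonneg fun c _ => mul_nonneg (by positivity) (E_nonneg σ c))
    refine Finset.sum_le_sum fun σ hσ => ?_
    rw [Finset.mem_filter] at hσ
    rw [← Finset.sum_sub_distrib]
    refine (Finset.abs_sum_le_sum_abs _ _).trans ?_
    refine le_trans ?_ (Finset.sum_le_sum_of_subset_of_nonneg
      (Finset.filter_subset_filter (fun c => π c = B)
        (Finset.subset_univ (Finset.univ.filter (Switchable π a σ))))
      fun c _ _ => mul_nonneg (by positivity) (E_nonneg σ c))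
    refine Finset.sum_le_sum fun c hc => ?_
    simp only [Finset.mem_filter, Finset.mem_univ, true_and] at hc
    -- Only the change in agreements matters, because the B–C count is invariant.
    have inv : h (conjSwap (σ a) c σ) = h σ := by
      have := crossCount_conjSwap hσ.1 hc.1 (by rw [hσ.2, hc.2]; exact hBC.symm)
      rw [hσ.2, hc.2] at this
      simp only [hh, this]
    have : f (conjSwap (σ a) c σ) - f σ = h σ *
        ((if agreements μ (conjSwap (σ a) c σ) = j then 1 else 0) -
          if agreements μ σ = j then 1 else 0) := by
      simp only [hf, inv]
      split_ifs <;> simp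
    rw [this, abs_mul, abs_of_nonneg (h_nonneg σ)]
    refine mul_le_mul (h_le σ) (abs_ite_sub_ite_le _ _ (E_nonneg σ c) ?_) (abs_nonneg _)
      (by positivity)
    by_cases i1 : σ a = μ a
    · right; simp only [hE, if_pos i1, add_assoc]; exact le_add_of_nonneg_right (by positivity)
    by_cases i2 : σ c = μ c
    · right; simp only [hE, if_neg i1, if_pos i2, zero_add, add_assoc]
      exact le_add_of_nonneg_right (by positivity)
    by_cases i3 : c = μ a
    · right; simp only [hE, if_neg i1, if_neg i2, if_pos i3, zero_add]
      exact le_add_of_nonneg_right (by positivity)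
    by_cases i4 : σ c = μ (σ a)
    · right; simp only [hE, if_neg i1, if_neg i2, if_neg i3, if_pos i4, zero_add, le_refl]
    left
    rw [agreements_conjSwap hμ hσ.1 hc.1 i1 i2 i3 i4]
  -- The first two terms of E contribute at most 2 T each, since m · 4 / (r * m) ≤ 2; each of the
  -- last two fixes c and contributes at most T.
  have E_sum : ∑ σ ∈ partInvolutions π, ∑ c with π c = B, E σ c ≤ 6 * T := by
    have p : ∀ x y : V, (m : ℝ) * ((partInvolutions π).filter fun σ => σ x = y).card ≤ 2 * T := by
      intro x y
      have b := card_partner_eq_le hm hV hr hN x y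
      have : (2 : ℝ) * m ≤ (r * m : ℕ) := by exact_mod_cast Nat.mul_le_mul_right m hr
      have := mul_le_mul_of_nonneg_right this
        (Nat.cast_nonneg (α := ℝ) ((partInvolutions π).filter fun σ => σ x = y).card)
      linarith
    simp only [hE, Finset.sum_add_distrib]
    have t1 : ∑ σ ∈ partInvolutions π, ∑ c with π c = B, (if σ a = μ a then (1 : ℝ) else 0) ≤
        2 * T := by
      simp only [Finset.sum_const, hm, nsmul_eq_mul, ← Finset.mul_sum, Finset.sum_boole]
      exact p a _
    have t2 : ∑ σ ∈ partInvolutions π, ∑ c with π c = B, (if σ c = μ c then (1 : ℝ) else 0) ≤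
        2 * T := by
      rw [Finset.sum_comm]
      simp only [Finset.sum_boole]
      refine le_of_mul_le_mul_left (a := (m : ℝ)) ?_ (by linarith)
      rw [Finset.mul_sum]
      refine (Finset.sum_le_sum fun c _ => p c (μ c)).trans ?_
      rw [Finset.sum_const, hm, nsmul_eq_mul]
    have t3 : ∑ σ ∈ partInvolutions π, ∑ c with π c = B, (if c = μ a then (1 : ℝ) else 0) ≤
        T := by
      rw [hT, ← mul_one ((partInvolutions π).card : ℝ), ← nsmul_eq_mul]
      refine Finset.sum_le_card_nsmul _ _ _ fun σ _ => ?_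
      rw [Finset.sum_ite_eq']
      split_ifs <;> norm_num
    have t4 : ∑ σ ∈ partInvolutions π, ∑ c with π c = B,
        (if σ c = μ (σ a) then (1 : ℝ) else 0) ≤ T := by
      rw [hT, ← mul_one ((partInvolutions π).card : ℝ), ← nsmul_eq_mul]
      refine Finset.sum_le_card_nsmul _ _ _ fun σ _ => ?_
      have : ∀ c, (σ c = μ (σ a)) = (c = σ.symm (μ (σ a))) := fun c =>
        propext (Equiv.eq_symm_apply σ).symm
      simp only [this]
      rw [Finset.sum_ite_eq']
      split_ifs <;> norm_num
    linarith
  simp_rw [← Finset.mul_sum] at diff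
  rw [count, count] at diff
  have bad : ∀ D : ι,
      ((((partInvolutions π).filter fun σ => π (σ a) = D ∧ agreements μ σ = j).card : ℝ) ≤
      ((partInvolutions π).filter fun σ =>
        (π (σ a) = D ∧ agreements μ σ = j) ∧ 4 * crossCount π σ C B ≤ 3 * m).card +
      ((partInvolutions π).filter fun σ => ¬ 4 * crossCount π σ C B ≤ 3 * m).card) ∧
      ((((partInvolutions π).filter fun σ =>
        (π (σ a) = D ∧ agreements μ σ = j) ∧ 4 * crossCount π σ C B ≤ 3 * m).card : ℝ) ≤
      ((partInvolutions π).filter fun σ => π (σ a) = D ∧ agreements μ σ = j).card) := by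
    intro D
    constructor
    · have : ((partInvolutions π).filter fun σ => π (σ a) = D ∧ agreements μ σ = j) ⊆
          ((partInvolutions π).filter fun σ =>
            (π (σ a) = D ∧ agreements μ σ = j) ∧ 4 * crossCount π σ C B ≤ 3 * m) ∪
          ((partInvolutions π).filter fun σ => ¬ 4 * crossCount π σ C B ≤ 3 * m) := by
        intro σ hσ
        simp only [Finset.mem_union, Finset.mem_filter] at hσ ⊢
        tauto
      exact_mod_cast (Finset.card_le_card this).trans (Finset.card_union_le _ _)
    · have : ((partInvolutions π).filter fun σ =>
            (π (σ a) = D ∧ agreements μ σ = j) ∧ 4 * crossCount π σ C B ≤ 3 * m) ⊆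
          ((partInvolutions π).filter fun σ => π (σ a) = D ∧ agreements μ σ = j) :=
        Finset.monotone_filter_right _ fun v _ hv => hv.1
      exact_mod_cast Finset.card_le_card this
  have bd := card_crossCount_large_le hm hm0 hB.symm hC.symm hBC
  have diff' := diff.trans (mul_le_mul_of_nonneg_left E_sum (by positivity))
  obtain ⟨b1, b2⟩ := bad B
  obtain ⟨c1, c2⟩ := bad C
  -- After multiplication by m the two errors are at most 24 T and 22 T, within the claimed 50 T.
  have tri : |(((partInvolutions π).filter fun σ =>
        π (σ a) = B ∧ agreements μ σ = j).card : ℝ) -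
      ((partInvolutions π).filter fun σ => π (σ a) = C ∧ agreements μ σ = j).card| ≤
      4 / m * (6 * T) +
      ((partInvolutions π).filter fun σ => ¬ 4 * crossCount π σ C B ≤ 3 * m).card := by
    rw [abs_le] at diff' ⊢
    constructor <;> linarith
  have tri' := mul_le_mul_of_nonneg_left tri (by linarith : (0 : ℝ) ≤ m)
  have : (m : ℝ) * (4 / m * (6 * T)) = 24 * T := by field_simp; ring
  have hT0 : 0 ≤ T := Nat.cast_nonneg _
  linarith

/-- Each edge of `μ` is in `σ` nearly independently of the number of agreements,
with an error that is small if the parts are large. -/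
theorem abs_card_partner_sub_le_of_large_parts [Fintype ι]
    (hm : ∀ i, (Finset.univ.filter fun v => π v = i).card = m)
    (hV : Fintype.card V = r * m) (hι : Fintype.card ι = r) (hr : 2 ≤ r) (hN : 24 ≤ r * m)
    (hμ : μ ∈ partInvolutions π) (a : V) (j : ℕ) :
    ((r * m : ℕ) : ℝ) * |((r : ℝ) - 1) * m *
        ((partInvolutions π).filter fun σ => σ a = μ a ∧ agreements μ σ = j + 2).card -
      ((partInvolutions π).filter fun σ => agreements μ σ = j).card| ≤
      58 * r ^ 2 * (partInvolutions π).card := by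
  have h1 := abs_card_partner_sub_card_part_le hm hV hr hN hμ a j
  have hm0 : 1 ≤ m := Nat.pos_of_ne_zero (by rintro rfl; simp at hN)
  have hm1 : (1 : ℝ) ≤ m := by exact_mod_cast hm0
  have hr1 : (2 : ℝ) ≤ r := by exact_mod_cast hr
  have hμa := (mem_partInvolutions.1 hμ).2 a
  set T : ℝ := ((partInvolutions π).card : ℝ)
  have hT : 0 ≤ T := Nat.cast_nonneg _
  set x : ι → ℝ := fun B =>
    (((partInvolutions π).filter fun σ => π (σ a) = B ∧ agreements μ σ = j).card : ℝ) with hx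
  have hsum : ∑ B ∈ Finset.univ.erase (π a), x B =
      ((partInvolutions π).filter fun σ => agreements μ σ = j).card := by
    rw [Finset.card_eq_sum_card_fiberwise (f := fun σ => π (σ a)) (t := Finset.univ.erase (π a))]
    · push_cast
      refine Finset.sum_congr rfl fun B _ => ?_
      simp only [hx]
      rw [Finset.filter_filter]
      simp only [and_comm]
    · intro σ hσ
      have : σ ∈ partInvolutions π := (Finset.mem_filter.1 (Finset.mem_coe.1 hσ)).1
      simpa using (mem_partInvolutions.1 this).2 a
  have hcard : ((Finset.univ.erase (π a)).card : ℝ) = r - 1 := by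
    rw [Finset.card_erase_of_mem (Finset.mem_univ _), Finset.card_univ, hι,
      Nat.cast_sub (by lia), Nat.cast_one]
  have h2 : (m : ℝ) * |((r : ℝ) - 1) * x (π (μ a)) -
      ((partInvolutions π).filter fun σ => agreements μ σ = j).card| ≤ (r - 1) * (50 * T) := by
    have e : ((r : ℝ) - 1) * x (π (μ a)) - ∑ B ∈ Finset.univ.erase (π a), x B =
        ∑ B ∈ Finset.univ.erase (π a), (x (π (μ a)) - x B) := by
      rw [Finset.sum_sub_distrib, Finset.sum_const, nsmul_eq_mul, hcard]
    rw [← hsum, e]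
    refine (mul_le_mul_of_nonneg_left (Finset.abs_sum_le_sum_abs _ _)
      (Nat.cast_nonneg (α := ℝ) m)).trans ?_
    rw [Finset.mul_sum]
    refine (Finset.sum_le_card_nsmul _ _ (50 * T) fun B hB => ?_).trans_eq
      (by rw [nsmul_eq_mul, hcard])
    exact abs_card_part_sub_card_part_le hm hV hr hN hμ hμa (Finset.mem_erase.1 hB).1 j
  set F : ℝ := (((partInvolutions π).filter fun σ =>
    σ a = μ a ∧ agreements μ σ = j + 2).card : ℝ)
  set P : ℝ := (((partInvolutions π).filter fun σ => agreements μ σ = j).card : ℝ)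
  have hN' : ((r * m : ℕ) : ℝ) = r * m := by push_cast; ring
  rw [hN'] at h1 ⊢
  -- The partner is first located in the part of μ a, with error 8, and that part is then compared
  -- with the average over the r - 1 parts other than that of a, with error 50.
  have tri : |((r : ℝ) - 1) * m * F - P| ≤
      (r - 1) * |m * F - x (π (μ a))| + |((r : ℝ) - 1) * x (π (μ a)) - P| := by
    have e : ((r : ℝ) - 1) * m * F - P =
        (r - 1) * (m * F - x (π (μ a))) + (((r : ℝ) - 1) * x (π (μ a)) - P) := by ring
    rw [e]
    refine (abs_add_le _ _).trans (le_of_eq ?_)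
    rw [abs_mul, abs_of_nonneg (by linarith : (0 : ℝ) ≤ r - 1)]
  calc (r : ℝ) * m * |((r : ℝ) - 1) * m * F - P| ≤
      r * m * ((r - 1) * |m * F - x (π (μ a))| + |((r : ℝ) - 1) * x (π (μ a)) - P|) := by gcongr
    _ = (r - 1) * (r * m * |m * F - x (π (μ a))|) +
        r * (m * |((r : ℝ) - 1) * x (π (μ a)) - P|) := by ring
    _ ≤ (r - 1) * (8 * T) + r * ((r - 1) * (50 * T)) := by
        gcongr
        linarith
    _ ≤ 58 * r ^ 2 * T := by nlinarith [mul_nonneg (by linarith : (0 : ℝ) ≤ r) hT]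

end Switching

/-! ### Stability of the Poisson recursion -/

section Poisson

/-- A probability distribution on `ℕ` that nearly satisfies the recursion of the Poisson
probabilities, and has a small tail, is close to the Poisson distribution. -/
theorem poisson_approximation {p : ℕ → ℝ} {l δ : ℝ} {K : ℕ} (hK : 1 ≤ K) (hl0 : 0 ≤ l)
    (hl1 : l ≤ 1) (hp : ∀ k, 0 ≤ p k) (hsum : HasSum p 1)
    (htail : 1 - ∑ k ∈ Finset.range K, p k ≤ 2 / K)
    (hrec : ∀ k : ℕ, |((k : ℝ) + 1) * p (k + 1) - l * p k| ≤ δ) :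
    (1 / 2 * ∑' k, |p k - Real.exp (-l) * l ^ k / k.factorial| ≤ 5 / K + 2 * (K * δ)) ∧
      |p 0 / Real.exp (-l) - 1| ≤ 3 * (2 / K + K * δ) := by
  set q : ℕ → ℝ := fun k => Real.exp (-l) * l ^ k / k.factorial with hq
  have hδ : 0 ≤ δ := (abs_nonneg _).trans (hrec 0)
  have hKpos : (0 : ℝ) < K := by exact_mod_cast hK
  have hq0 : ∀ k, 0 ≤ q k := fun k => by simp only [hq]; positivity
  have hqsum : HasSum q 1 := by
    have := ProbabilityTheory.hasSum_one_poissonMeasure ⟨l, hl0⟩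
    exact this
  have hexp1 : Real.exp (-l) ≤ 1 := Real.exp_le_one_iff.2 (by linarith)
  have hexp3 : Real.exp l ≤ 3 :=
    (Real.exp_le_exp.2 hl1).trans (by have := Real.exp_one_lt_d9; linarith)
  have hexpmul : Real.exp (-l) * Real.exp l = 1 := by rw [← Real.exp_add]; simp
  set s : ℕ → ℝ := fun k => l ^ k / k.factorial with hs
  have hs0 : ∀ k, 0 ≤ s k := fun k => by simp only [hs]; positivity
  have hqs : ∀ k, q k = Real.exp (-l) * s k := fun k => by simp only [hq, hs, mul_div_assoc]
  have sle : ∑ k ∈ Finset.range K, s k ≤ 3 := (Real.sum_le_exp_of_nonneg hl0 K).trans hexp3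
  have sge : 1 ≤ ∑ k ∈ Finset.range K, s k := by
    have := Finset.single_le_sum (f := s) (fun k _ => hs0 k) (Finset.mem_range.2 hK)
    simpa [hs] using this
  have hqtail : 1 - ∑ k ∈ Finset.range K, q k ≤ 2 / K := by
    have h := Real.exp_bound' hl0 hl1 hK
    have h1 : l ^ K * (K + 1) / (K.factorial * K) ≤ 2 / K := by
      have f1 : (K : ℝ) ≤ K.factorial := by exact_mod_cast Nat.self_le_factorial K
      have f2 : l ^ K ≤ 1 := pow_le_one₀ hl0 hl1
      have f3 : (1 : ℝ) ≤ K := by exact_mod_cast hK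
      rw [div_le_div_iff₀ (by positivity) hKpos]
      have : l ^ K * (K + 1) ≤ 2 * K.factorial := by nlinarith
      nlinarith
    simp_rw [hqs]
    rw [← Finset.mul_sum, ← hexpmul, ← mul_sub]
    have h2 : Real.exp l - ∑ k ∈ Finset.range K, s k ≤ 2 / K := by linarith
    have h3 : 0 ≤ 2 / (K : ℝ) := by positivity
    nlinarith [Real.exp_pos (-l)]
  set D : ℕ → ℝ := fun k => p k - q k with hD
  have hDrec : ∀ k : ℕ, |((k : ℝ) + 1) * D (k + 1) - l * D k| ≤ δ := by
    intro k
    have : ((k : ℝ) + 1) * q (k + 1) = l * q k := by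
      simp only [hq, Nat.factorial_succ, pow_succ]
      push_cast
      field_simp
    have h := hrec k
    have e : ((k : ℝ) + 1) * D (k + 1) - l * D k = ((k : ℝ) + 1) * p (k + 1) - l * p k := by
      simp only [hD]
      linear_combination -this
    rwa [e]
  -- Errors do not accumulate: the deviation vanishes at k = 0, and for k ≥ 1 the bound δ + l δ ≤ 2
  -- δ is absorbed by the factor k + 1 on the left.
  have herr : ∀ k, |D k - D 0 * s k| ≤ δ := by
    intro k
    induction k with
    | zero => simpa [hs] using hδ
    | succ k ih =>
      have hsk : ((k : ℝ) + 1) * s (k + 1) = l * s k := by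
        simp only [hs, Nat.factorial_succ, pow_succ]
        push_cast
        field_simp
      have e : ((k : ℝ) + 1) * (D (k + 1) - D 0 * s (k + 1)) =
          (((k : ℝ) + 1) * D (k + 1) - l * D k) + l * (D k - D 0 * s k) := by
        linear_combination -D 0 * hsk
      have h1 : ((k : ℝ) + 1) * |D (k + 1) - D 0 * s (k + 1)| ≤ δ + l * |D k - D 0 * s k| := by
        have hk : (0 : ℝ) ≤ (k : ℝ) + 1 := by positivity
        have e' : ((k : ℝ) + 1) * |D (k + 1) - D 0 * s (k + 1)| =
            |((k : ℝ) + 1) * (D (k + 1) - D 0 * s (k + 1))| := by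
          rw [abs_mul, abs_of_nonneg hk]
        rw [e', e]
        refine (abs_add_le _ _).trans ?_
        rw [abs_mul l, abs_of_nonneg hl0]
        linarith [hDrec k]
      rcases Nat.eq_zero_or_pos k with rfl | hk
      · simp [hs] at h1 ⊢
        exact h1
      · have : (1 : ℝ) ≤ k := by exact_mod_cast hk
        have := mul_le_mul hl1 ih (abs_nonneg _) zero_le_one
        nlinarith [abs_nonneg (D (k + 1) - D 0 * s (k + 1))]
  have ple : ∑ k ∈ Finset.range K, p k ≤ 1 := sum_le_hasSum _ (fun k _ => hp k) hsum
  have qle : ∑ k ∈ Finset.range K, q k ≤ 1 := sum_le_hasSum _ (fun k _ => hq0 k) hqsum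
  -- Both distributions have mass at least 1 - 2 / K below K, so the differences D nearly sum to
  -- zero there; they are nearly D 0 times nonnegative numbers of sum at least 1, so D 0 is small.
  have hD0 : |D 0| ≤ 2 / K + K * δ := by
    have h1 : |∑ k ∈ Finset.range K, D k| ≤ 2 / K := by
      simp only [hD]
      rw [Finset.sum_sub_distrib, abs_le]
      constructor <;> linarith
    have h2 : |∑ k ∈ Finset.range K, (D k - D 0 * s k)| ≤ K * δ := by
      refine (Finset.abs_sum_le_sum_abs _ _).trans ?_
      refine (Finset.sum_le_card_nsmul _ _ δ fun k _ => herr k).trans_eq ?_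
      simp
    rw [Finset.sum_sub_distrib, ← Finset.mul_sum] at h2
    have h3 : |D 0 * ∑ k ∈ Finset.range K, s k| ≤ 2 / K + K * δ := by
      rw [abs_le] at h1 h2 ⊢
      constructor <;> linarith
    rw [abs_mul, abs_of_nonneg (zero_le_one.trans sge)] at h3
    exact (le_mul_of_one_le_right (abs_nonneg _) sge).trans h3
  constructor
  · have hsub : Summable fun k => |D k| := (hsum.summable.sub hqsum.summable).abs
    have hpq : Summable fun k => p k + q k := hsum.summable.add hqsum.summable
    have h1 := hsub.sum_add_tsum_nat_add K
    have h2 := hpq.sum_add_tsum_nat_add K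
    have h3 : ∑' k, |D (k + K)| ≤ ∑' k, (p (k + K) + q (k + K)) := by
      refine Summable.tsum_le_tsum (fun k => ?_) ((summable_nat_add_iff K).2 hsub)
        ((summable_nat_add_iff K).2 hpq)
      simp only [hD]
      rw [abs_le]
      constructor <;> linarith [hp (k + K), hq0 (k + K)]
    rw [(hsum.add hqsum).tsum_eq, Finset.sum_add_distrib] at h2
    -- With the two tails of 2 / K each, this bounds the full sum by 10 / K + 4 K δ, and half of it
    -- is the claim.
    have h4 : ∑ k ∈ Finset.range K, |D k| ≤ |D 0| * 3 + K * δ := by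
      calc ∑ k ∈ Finset.range K, |D k| ≤ ∑ k ∈ Finset.range K, (|D 0| * s k + δ) := by
            refine Finset.sum_le_sum fun k _ => ?_
            have h5 := herr k
            have h6 : |D k| ≤ |D k - D 0 * s k| + |D 0 * s k| := by
              simpa using abs_add_le (D k - D 0 * s k) (D 0 * s k)
            rw [abs_mul, abs_of_nonneg (hs0 k)] at h6
            linarith
        _ = |D 0| * ∑ k ∈ Finset.range K, s k + K * δ := by
            rw [Finset.sum_add_distrib, ← Finset.mul_sum]
            simp
        _ ≤ _ := by gcongr
    have e : (10 : ℝ) / K = 5 * (2 / K) := by ring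
    have e' : (5 : ℝ) / K = 5 / 2 * (2 / K) := by ring
    change 1 / 2 * ∑' k, |D k| ≤ _
    linarith
  · have e : p 0 / Real.exp (-l) - 1 = D 0 * Real.exp l := by
      simp only [hD, hq]
      rw [Real.exp_neg]
      field_simp
      simp
    rw [e, abs_mul, abs_of_nonneg (Real.exp_pos l).le, mul_comm]
    gcongr

end Poisson

/-! ### The approximate Poisson recursion and the tail bound -/

section Switching

variable {V ι : Type*} [Fintype V] [DecidableEq V] [DecidableEq ι]
variable {π : V → ι} {σ μ : Equiv.Perm V} {m r : ℕ}

/-- Double counting: a permutation with j agreements is counted once for each agreeing vertex. -/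
theorem sum_card_partner (Ω : Finset (Equiv.Perm V)) (μ : Equiv.Perm V) (j : ℕ) :
    ∑ a, ((Ω.filter fun σ => σ a = μ a ∧ agreements μ σ = j).card : ℝ) =
      j * (Ω.filter fun σ => agreements μ σ = j).card := by
  simp_rw [← Finset.sum_boole]
  rw [Finset.sum_comm, Finset.mul_sum]
  refine Finset.sum_congr rfl fun σ _ => ?_
  by_cases h : agreements μ σ = j
  · simp only [h, and_true, if_true, mul_one, Finset.sum_boole]
    rw [← h, agreements]
  · simp [h]

/-- The Poisson recursion for the number of common edges. -/
theorem abs_succ_mul_sub_le [Fintype ι] {ε : ℝ}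
    (hm : ∀ i, (Finset.univ.filter fun v => π v = i).card = m)
    (hV : Fintype.card V = r * m) (hι : Fintype.card ι = r) (hr : 2 ≤ r) (hN : 24 ≤ r * m)
    (R : ℕ) (hR : 16 ≤ ε * R) (hε : 58 * (R : ℝ) ^ 2 ≤ ε * (r * m : ℕ))
    (hμ : μ ∈ partInvolutions π) (k : ℕ) :
    |((k : ℝ) + 1) * ((partInvolutions π).filter fun σ =>
        agreements μ σ = 2 * (k + 1)).card -
      rate r * ((partInvolutions π).filter fun σ => agreements μ σ = 2 * k).card| ≤
      ε * (partInvolutions π).card := by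
  set T : ℝ := ((partInvolutions π).card : ℝ)
  have hT : 0 ≤ T := Nat.cast_nonneg _
  have hm0 : 1 ≤ m := Nat.pos_of_ne_zero (by rintro rfl; simp at hN)
  have hm1 : (1 : ℝ) ≤ m := by exact_mod_cast hm0
  have hr1 : (2 : ℝ) ≤ r := by exact_mod_cast hr
  have hN' : (0 : ℝ) < (r * m : ℕ) := by exact_mod_cast (by lia : 0 < r * m)
  have hεpos : 0 < ε := by
    by_contra! h
    have : ε * (R : ℝ) ≤ 0 := mul_nonpos_of_nonpos_of_nonneg h (Nat.cast_nonneg _)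
    linarith
  have edge : ∀ a, |((r : ℝ) - 1) * m * ((partInvolutions π).filter fun σ =>
      σ a = μ a ∧ agreements μ σ = 2 * k + 2).card -
      ((partInvolutions π).filter fun σ => agreements μ σ = 2 * k).card| ≤ ε * T := by
    intro a
    -- The threshold R separates the regimes: from R parts on the error 16 / r is small, and up to R
    -- parts the error 58 r² / (r * m) is.
    rcases le_total R r with h | h
    · have h1 := abs_card_partner_sub_le_of_parts hm hV hr hN hμ a (2 * k)
      have h' : (R : ℝ) ≤ r := by exact_mod_cast h
      refine le_of_mul_le_mul_left (h1.trans ?_) (by linarith : (0 : ℝ) < r)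
      have : (16 : ℝ) ≤ ε * r := hR.trans (by gcongr)
      have := mul_le_mul_of_nonneg_right this hT
      linarith
    · have h1 := abs_card_partner_sub_le_of_large_parts hm hV hι hr hN hμ a (2 * k)
      have h' : (r : ℝ) ≤ R := by exact_mod_cast h
      refine le_of_mul_le_mul_left (h1.trans ?_) hN'
      have : 58 * (r : ℝ) ^ 2 ≤ ε * (r * m : ℕ) := le_trans (by gcongr) hε
      have := mul_le_mul_of_nonneg_right this hT
      linarith
  have total := Finset.sum_le_card_nsmul Finset.univ _ (ε * T) fun a _ => edge a
  rw [Finset.card_univ, hV, nsmul_eq_mul] at total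
  have h1 := (Finset.abs_sum_le_sum_abs _ _).trans total
  rw [Finset.sum_sub_distrib, ← Finset.mul_sum, sum_card_partner, Finset.sum_const,
    Finset.card_univ, hV, nsmul_eq_mul] at h1
  set x : ℝ := (((partInvolutions π).filter fun σ => agreements μ σ = 2 * (k + 1)).card : ℝ)
  set y : ℝ := (((partInvolutions π).filter fun σ => agreements μ σ = 2 * k).card : ℝ)
  have e2 : (((partInvolutions π).filter fun σ => agreements μ σ = 2 * k + 2).card : ℝ) = x := rfl
  rw [e2] at h1
  have hr2 : (0 : ℝ) < 2 * r - 2 := by linarith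
  have e3 : ((r : ℝ) - 1) * m * ((2 * k + 2 : ℕ) * x) - (r * m : ℕ) * y =
      ((2 * r - 2) * m) * (((k : ℝ) + 1) * x - rate r * y) := by
    have hrate : rate r * (2 * r - 2) = r := div_mul_cancel₀ _ hr2.ne'
    push_cast
    linear_combination (m * y : ℝ) * hrate
  rw [e3, abs_mul, abs_of_pos (by positivity)] at h1
  refine le_of_mul_le_mul_left (h1.trans ?_) (by positivity : 0 < (2 * (r : ℝ) - 2) * m)
  -- The summed error r * m · ε T is divided by (2r - 2) m, which costs nothing because r ≤ 2r - 2.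
  refine mul_le_mul_of_nonneg_right ?_ (by positivity)
  push_cast
  nlinarith

/-- Two random matchings have few common edges. -/
theorem mul_card_agreements_ge_le (hm : ∀ i, (Finset.univ.filter fun v => π v = i).card = m)
    (hV : Fintype.card V = r * m) (hr : 2 ≤ r) (hN : 24 ≤ r * m) (μ : Equiv.Perm V) (K : ℕ) :
    (K : ℝ) * ((partInvolutions π).filter fun σ => 2 * K ≤ agreements μ σ).card ≤
      2 * (partInvolutions π).card := by
  -- The expected number of agreements is at most 4, one term 4 / (r * m) per vertex; Markov's
  -- inequality at 2K then gives 2 / K.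
  have h1 : ∑ σ ∈ partInvolutions π, (agreements μ σ : ℝ) ≤ 4 * (partInvolutions π).card := by
    have hN' : (0 : ℝ) < (r * m : ℕ) := by exact_mod_cast (by lia : 0 < r * m)
    have e : ∑ σ ∈ partInvolutions π, (agreements μ σ : ℝ) =
        ∑ a, (((partInvolutions π).filter fun σ => σ a = μ a).card : ℝ) := by
      simp_rw [agreements, ← Finset.sum_boole]
      rw [Finset.sum_comm]
    rw [e]
    refine le_of_mul_le_mul_left ?_ hN'
    rw [Finset.mul_sum]
    refine (Finset.sum_le_card_nsmul _ _ _ fun a _ =>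
      card_partner_eq_le hm hV hr hN a (μ a)).trans_eq ?_
    rw [Finset.card_univ, hV, nsmul_eq_mul]
  have h2 : ((partInvolutions π).filter fun σ => 2 * K ≤ agreements μ σ).card * (2 * K : ℝ) ≤
      ∑ σ ∈ partInvolutions π, (agreements μ σ : ℝ) := by
    rw [Finset.card_filter, Nat.cast_sum, Finset.sum_mul]
    refine Finset.sum_le_sum fun σ _ => ?_
    split_ifs with h
    · simpa using (by exact_mod_cast h : (2 * K : ℝ) ≤ agreements μ σ)
    · simp
  linarith

end Switching

/-! ### Perfect matchings as involutions, and the law of the shared edges -/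

section Matchings

variable {V : Type*} {G : SimpleGraph V}

/-- The vertex matched with `v`. -/
noncomputable def PerfectMatching.partner (P : PerfectMatching G) (v : V) : V :=
  (SimpleGraph.Subgraph.isPerfectMatching_iff.1 P.2 v).choose

theorem PerfectMatching.adj_iff (P : PerfectMatching G) (v w : V) :
    P.1.Adj v w ↔ P.partner v = w := by
  have h := (SimpleGraph.Subgraph.isPerfectMatching_iff.1 P.2 v).choose_spec
  constructor
  · intro h1
    exact (h.2 w h1).symm
  · rintro rfl
    exact h.1

theorem PerfectMatching.partner_involutive (P : PerfectMatching G) :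
    Function.Involutive P.partner := fun v =>
  (P.adj_iff _ _).1 (((P.adj_iff v _).2 rfl).symm)

/-- Perfect matchings correspond to the involutions along edges. -/
noncomputable def perfectMatchingEquiv (G : SimpleGraph V) : PerfectMatching G ≃
    {σ : Equiv.Perm V // (∀ v, σ (σ v) = v) ∧ ∀ v, G.Adj v (σ v)} where
  toFun P := ⟨P.partner_involutive.toPerm, P.partner_involutive,
    fun v => ((P.adj_iff v _).2 rfl).adj_sub⟩
  invFun σ := ⟨{
      verts := Set.univ
      Adj := fun v w => σ.1 v = w
      adj_sub := by rintro v w rfl; exact σ.2.2 v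
      edge_vert := fun _ => Set.mem_univ _
      symm := ⟨by rintro v w rfl; exact σ.2.1 v⟩ },
    SimpleGraph.Subgraph.isPerfectMatching_iff.2 fun v => ⟨σ.1 v, rfl, fun _ h => Eq.symm (show σ.1 v = _ from h)⟩⟩
  left_inv P := by
    refine Subtype.ext (SimpleGraph.Subgraph.ext ?_ ?_)
    · exact (Set.eq_univ_of_forall P.2.2).symm
    · ext v w
      exact (P.adj_iff v w).symm
  right_inv σ := by
    refine Subtype.ext (Equiv.ext fun v => ?_)
    exact ((PerfectMatching.adj_iff _ v (σ.1 v)).1 rfl)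

theorem PerfectMatching.adj_iff_equiv (P : PerfectMatching G) (v w : V) :
    P.1.Adj v w ↔ (perfectMatchingEquiv G P).1 v = w := P.adj_iff v w

/-- The map v ↦ {v, μ v} sends agreeing vertices to shared edges, and its fibre over each shared
edge is the pair of endpoints. -/
theorem two_mul_sharedEdges [Fintype V] [DecidableEq V] (M P : PerfectMatching G) :
    2 * sharedEdges M P =
      agreements (perfectMatchingEquiv G M).1 (perfectMatchingEquiv G P).1 := by
  classical
  set μ := (perfectMatchingEquiv G M).1 with hμ
  set σ := (perfectMatchingEquiv G P).1 with hσ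
  have h1 := (perfectMatchingEquiv G M).2.1
  have h2 := (perfectMatchingEquiv G M).2.2
  rw [← hμ] at h1 h2
  rw [sharedEdges, Set.ncard_eq_toFinset_card', agreements,
    Finset.card_eq_sum_card_fiberwise (f := fun v => s(v, μ v))
      (t := (M.1.edgeSet ∩ P.1.edgeSet).toFinset)]
  · rw [Finset.sum_const_nat (m := 2), mul_comm]
    intro e he
    induction e with
    | h a b =>
    rw [Set.mem_toFinset] at he
    have ha : μ a = b := (M.adj_iff_equiv a b).1 he.1
    have hb : σ a = b := (P.adj_iff_equiv a b).1 he.2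
    have hab : a ≠ b := fun h => (h2 a).ne (h.trans ha.symm)
    have hs : σ b = a := by rw [← hb]; exact (perfectMatchingEquiv G P).2.1 a
    have hm : μ b = a := by rw [← ha]; exact h1 a
    rw [Finset.card_eq_two]
    refine ⟨a, b, hab, ?_⟩
    ext v
    simp only [Finset.mem_filter, Finset.mem_univ, true_and, Finset.mem_insert,
      Finset.mem_singleton, Sym2.eq_iff]
    constructor
    · rintro ⟨_, h | h⟩
      · exact Or.inl h.1
      · exact Or.inr h.1
    · rintro (rfl | rfl)
      · exact ⟨hb.trans ha.symm, Or.inl ⟨rfl, ha⟩⟩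
      · exact ⟨hs.trans hm.symm, Or.inr ⟨rfl, hm⟩⟩
  · intro v hv
    have hv' : σ v = μ v := by simpa using hv
    rw [Finset.mem_coe, Set.mem_toFinset]
    exact ⟨(M.adj_iff_equiv v _).2 rfl, (P.adj_iff_equiv v _).2 hv'⟩

theorem sharedLaw_real_singleton [Finite V] (M : PerfectMatching G) (k : ℕ) :
    (sharedLaw M).real {k} =
      (Nat.card {P : PerfectMatching G // sharedEdges M P = k} : ℝ) / pm G := by
  classical
  have : Fintype (PerfectMatching G) := Fintype.ofFinite _
  have : Nonempty (PerfectMatching G) := ⟨M⟩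
  have hU : uniformMatching M = PMF.uniformOfFintype (PerfectMatching G) := by
    rw [uniformMatching]
    congr!
  rw [sharedLaw, MeasureTheory.Measure.real,
    PMF.toMeasure_apply_singleton _ _ (MeasurableSet.singleton k), PMF.map_apply, hU,
    tsum_fintype]
  simp only [PMF.uniformOfFintype_apply, eq_comm (a := k)]
  rw [← Finset.sum_filter, Finset.sum_const, nsmul_eq_mul, ENNReal.toReal_mul, ENNReal.toReal_inv,
    ENNReal.toReal_natCast, ENNReal.toReal_natCast, pm, Nat.card_eq_fintype_card,
    Nat.card_eq_fintype_card, Fintype.card_subtype (fun P => sharedEdges M P = k), div_eq_mul_inv]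

variable {ι : Type*} [Fintype V] [DecidableEq V] [DecidableEq ι] {π : V → ι}

theorem mem_partInvolutions_iff_adj (hG : ∀ v w, G.Adj v w ↔ π v ≠ π w) (σ : Equiv.Perm V) :
    σ ∈ partInvolutions π ↔ (∀ v, σ (σ v) = v) ∧ ∀ v, G.Adj v (σ v) := by
  rw [mem_partInvolutions]
  simp only [hG]
  exact and_congr_right fun _ => forall_congr' fun _ => ne_comm

theorem pm_eq_card_partInvolutions (hG : ∀ v w, G.Adj v w ↔ π v ≠ π w) :
    pm G = (partInvolutions π).card := by
  rw [pm, Nat.card_congr (perfectMatchingEquiv G), ← Nat.card_eq_finsetCard]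
  exact Nat.card_congr (Equiv.subtypeEquivRight fun σ => (mem_partInvolutions_iff_adj hG σ).symm)

theorem card_sharedEdges_eq (hG : ∀ v w, G.Adj v w ↔ π v ≠ π w) (M : PerfectMatching G) (k : ℕ) :
    Nat.card {P : PerfectMatching G // sharedEdges M P = k} =
      ((partInvolutions π).filter fun σ =>
        agreements (perfectMatchingEquiv G M).1 σ = 2 * k).card := by
  rw [← Nat.card_eq_finsetCard]
  refine Nat.card_congr ⟨fun P => ⟨(perfectMatchingEquiv G P.1).1, ?_⟩,
    fun σ => ⟨(perfectMatchingEquiv G).symm ⟨σ.1, ?_⟩, ?_⟩, ?_, ?_⟩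
  · rw [Finset.mem_filter, mem_partInvolutions_iff_adj hG, ← two_mul_sharedEdges, P.2]
    exact ⟨(perfectMatchingEquiv G P.1).2, rfl⟩
  · exact (mem_partInvolutions_iff_adj hG _).1 (Finset.mem_filter.1 σ.2).1
  · have h := (Finset.mem_filter.1 σ.2).2
    have h1 := two_mul_sharedEdges M ((perfectMatchingEquiv G).symm
      ⟨σ.1, (mem_partInvolutions_iff_adj hG _).1 (Finset.mem_filter.1 σ.2).1⟩)
    rw [Equiv.apply_symm_apply] at h1
    have h2 := h1.trans h
    lia
  · intro P
    simp
  · intro σ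
    simp

theorem pm_deleteEdges_eq (hG : ∀ v w, G.Adj v w ↔ π v ≠ π w) (M : PerfectMatching G) :
    pm (G.deleteEdges M.1.edgeSet) = ((partInvolutions π).filter fun σ =>
        agreements (perfectMatchingEquiv G M).1 σ = 0).card := by
  rw [pm, Nat.card_congr (perfectMatchingEquiv _), ← Nat.card_eq_finsetCard]
  refine Nat.card_congr (Equiv.subtypeEquivRight fun σ => ?_)
  rw [Finset.mem_filter, mem_partInvolutions_iff_adj hG, and_assoc, agreements,
    Finset.card_eq_zero, Finset.filter_eq_empty_iff]
  refine and_congr_right fun _ => ?_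
  simp only [SimpleGraph.deleteEdges_adj, forall_and, Finset.mem_univ, true_implies,
    SimpleGraph.Subgraph.mem_edgeSet, PerfectMatching.adj_iff_equiv, eq_comm]

end Matchings

/-! ### Assembly of the uniform estimate and its consequences -/

section Main

theorem rate_nonneg {r : ℕ} (hr : 2 ≤ r) : 0 ≤ rate r := by
  have : (2 : ℝ) ≤ r := by exact_mod_cast hr
  exact div_nonneg (by linarith) (by linarith)

theorem rate_le_one {r : ℕ} (hr : 2 ≤ r) : rate r ≤ 1 := by
  have : (2 : ℝ) ≤ r := by exact_mod_cast hr
  exact div_le_one_of_le₀ (by linarith) (by linarith)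

theorem hasSum_sharedLaw {V : Type*} [Finite V] {G : SimpleGraph V} (M : PerfectMatching G) :
    HasSum (fun k => (sharedLaw M).real {k}) 1 := by
  have h := ((uniformMatching M).map (sharedEdges M)).tsum_coe
  have h1 := ENNReal.hasSum_toReal (f := (uniformMatching M).map (sharedEdges M))
    (by rw [h]; exact ENNReal.one_ne_top)
  rw [← ENNReal.tsum_toReal_eq fun k => PMF.apply_ne_top _ k, h, ENNReal.toReal_one] at h1
  convert h1 using 2 with k
  rw [sharedLaw, MeasureTheory.Measure.real,
    PMF.toMeasure_apply_singleton _ _ (MeasurableSet.singleton k)]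

variable {V ι : Type*} [Fintype V] [DecidableEq V] [DecidableEq ι] {G : SimpleGraph V}
variable {π : V → ι} {m r : ℕ}

theorem sharedLaw_real_singleton_eq (hG : ∀ v w, G.Adj v w ↔ π v ≠ π w)
    (M : PerfectMatching G) (k : ℕ) :
    (sharedLaw M).real {k} = (((partInvolutions π).filter fun σ =>
        agreements (perfectMatchingEquiv G M).1 σ = 2 * k).card : ℝ) /
          (partInvolutions π).card := by
  rw [sharedLaw_real_singleton, card_sharedEdges_eq hG, pm_eq_card_partInvolutions hG]

theorem card_partInvolutions_pos (hG : ∀ v w, G.Adj v w ↔ π v ≠ π w)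
    (M : PerfectMatching G) : (0 : ℝ) < (partInvolutions π).card :=
  Nat.cast_pos.2 (Finset.card_pos.2
    ⟨_, (mem_partInvolutions_iff_adj hG _).2 (perfectMatchingEquiv G M).2⟩)

/-- A perfect matching of G - M is a perfect matching of G sharing no edge with M, so the ratio is
the probability of the value 0. -/
theorem derangedRatio_eq (hG : ∀ v w, G.Adj v w ↔ π v ≠ π w) (M : PerfectMatching G) :
    derangedRatio M = (sharedLaw M).real {0} := by
  rw [derangedRatio, sharedLaw_real_singleton_eq hG, pm_deleteEdges_eq hG,
    pm_eq_card_partInvolutions hG]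

theorem sharedLaw_tail_le (hG : ∀ v w, G.Adj v w ↔ π v ≠ π w)
    (hm : ∀ i, (Finset.univ.filter fun v => π v = i).card = m)
    (hV : Fintype.card V = r * m) (hr : 2 ≤ r) (hN : 24 ≤ r * m) (M : PerfectMatching G)
    {K : ℕ} (hK : 1 ≤ K) :
    1 - ∑ k ∈ Finset.range K, (sharedLaw M).real {k} ≤ 2 / K := by
  have hT := card_partInvolutions_pos hG M
  have hK' : (0 : ℝ) < K := by exact_mod_cast hK
  set μ := (perfectMatchingEquiv G M).1
  have h1 := mul_card_agreements_ge_le hm hV hr hN μ K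
  have h2 : (partInvolutions π).card ≤ (∑ k ∈ Finset.range K,
      ((partInvolutions π).filter fun σ => agreements μ σ = 2 * k).card) +
      ((partInvolutions π).filter fun σ => 2 * K ≤ agreements μ σ).card := by
    refine (Finset.card_le_card ?_).trans ((Finset.card_union_le ((Finset.range K).biUnion fun k =>
      (partInvolutions π).filter fun σ => agreements μ σ = 2 * k) _).trans
        (Nat.add_le_add_right Finset.card_biUnion_le _))
    -- Agreements are even, being twice the number of shared edges, so the classes 2k with k < K
    -- exhaust the values below 2K.
    intro σ hσ
    have h3 := two_mul_sharedEdges M ((perfectMatchingEquiv G).symm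
      ⟨σ, (mem_partInvolutions_iff_adj hG _).1 hσ⟩)
    rw [Equiv.apply_symm_apply] at h3
    simp only [Finset.mem_union, Finset.mem_biUnion, Finset.mem_range, Finset.mem_filter]
    rcases lt_or_ge (agreements μ σ) (2 * K) with h | h
    · refine Or.inl ⟨_, ?_, hσ, h3.symm⟩
      have : 2 * sharedEdges M _ < 2 * K := h3.trans_lt h
      lia
    · exact Or.inr ⟨hσ, h⟩
  have h2' : ((partInvolutions π).card : ℝ) ≤ (∑ k ∈ Finset.range K,
      (((partInvolutions π).filter fun σ => agreements μ σ = 2 * k).card : ℝ)) +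
      ((partInvolutions π).filter fun σ => 2 * K ≤ agreements μ σ).card := by
    exact_mod_cast h2
  simp_rw [sharedLaw_real_singleton_eq hG]
  rw [← Finset.sum_div, one_sub_div hT.ne', div_le_div_iff₀ hT hK']
  nlinarith [mul_le_mul_of_nonneg_left h2' hK'.le]

theorem sharedLaw_poisson_recursion [Fintype ι] {δ : ℝ} (hG : ∀ v w, G.Adj v w ↔ π v ≠ π w)
    (hm : ∀ i, (Finset.univ.filter fun v => π v = i).card = m)
    (hV : Fintype.card V = r * m) (hι : Fintype.card ι = r) (hr : 2 ≤ r) (hN : 24 ≤ r * m)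
    (R : ℕ) (hR : 16 ≤ δ * R) (hδ : 58 * (R : ℝ) ^ 2 ≤ δ * (r * m : ℕ))
    (M : PerfectMatching G) (k : ℕ) :
    |((k : ℝ) + 1) * (sharedLaw M).real {k + 1} - rate r * (sharedLaw M).real {k}| ≤ δ := by
  have hT := card_partInvolutions_pos hG M
  have h := abs_succ_mul_sub_le hm hV hι hr hN R hR hδ
    ((mem_partInvolutions_iff_adj hG _).2 (perfectMatchingEquiv G M).2) k
  rw [sharedLaw_real_singleton_eq hG, sharedLaw_real_singleton_eq hG, ← mul_div_assoc,
    ← mul_div_assoc, ← sub_div, abs_div, abs_of_pos hT, div_le_iff₀ hT]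
  exact h

theorem exists_forall_poissonError_lt {ε : ℝ} (hε : 0 < ε) :
    ∃ N : ℕ, ∀ n : ℕ, N ≤ n → ∀ r : ℕ, 2 ≤ r → r ∣ 2 * n →
      ∀ M : PerfectMatching (balancedMultipartite r n),
        poissonError M < ε ∧ |derangedRatio M / Real.exp (-(rate r)) - 1| < ε := by
  -- K makes the tail terms less than ε / 2, and δ = ε / (8K) keeps the recursion terms 2Kδ and 3Kδ
  -- below ε / 2. R and then N are chosen for the two regimes of the recursion at precision δ; n ≥
  -- 12 supplies 24 ≤ 2n.
  obtain ⟨K, hK⟩ := exists_nat_gt (12 / ε)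
  have hK0 : (0 : ℝ) < K := (by positivity : 0 < 12 / ε).trans hK
  have hK1 : 1 ≤ K := by exact_mod_cast hK0
  set δ := ε / (8 * K) with hδ
  have hδ0 : 0 < δ := by positivity
  obtain ⟨R, hR⟩ := exists_nat_gt (16 / δ)
  obtain ⟨N, hN⟩ := exists_nat_gt (58 * (R : ℝ) ^ 2 / δ)
  refine ⟨max N 12, fun n hn r hr hdvd M => ?_⟩
  have hrm : r * (2 * n / r) = 2 * n := Nat.mul_div_cancel' hdvd
  have hG : ∀ v w, (balancedMultipartite r n).Adj v w ↔ v.1 ≠ w.1 := fun v w =>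
    SimpleGraph.completeEquipartiteGraph_adj
  have hm : ∀ i : Fin r, (Finset.univ.filter fun v : Fin r × Fin (2 * n / r) => v.1 = i).card =
      2 * n / r := by
    intro i
    have : (Finset.univ.filter fun v : Fin r × Fin (2 * n / r) => v.1 = i) =
        ({i} : Finset (Fin r)) ×ˢ Finset.univ := by
      ext v
      simp only [Finset.mem_filter, Finset.mem_univ, true_and, Finset.mem_product,
        Finset.mem_singleton, and_true]
    rw [this, Finset.card_product]
    simp
  have hV : Fintype.card (Fin r × Fin (2 * n / r)) = r * (2 * n / r) := by simp
  have h24 : 24 ≤ r * (2 * n / r) := by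
    have := (le_max_right N 12).trans hn
    lia
  have hNn : (N : ℝ) ≤ n := by exact_mod_cast (le_max_left N 12).trans hn
  have hR' : 16 ≤ δ * R := by
    rw [div_lt_iff₀ hδ0] at hR
    linarith
  have hδ' : 58 * (R : ℝ) ^ 2 ≤ δ * (r * (2 * n / r) : ℕ) := by
    rw [hrm]
    rw [div_lt_iff₀ hδ0] at hN
    push_cast
    nlinarith
  obtain ⟨h1, h2⟩ := poisson_approximation hK1 (rate_nonneg hr) (rate_le_one hr)
    (fun k => MeasureTheory.measureReal_nonneg) (hasSum_sharedLaw M)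
    (sharedLaw_tail_le hG hm hV hr h24 M hK1)
    (sharedLaw_poisson_recursion hG hm hV (Fintype.card_fin r) hr h24 R hR' hδ' M)
  have hKδ : K * δ = ε / 8 := by rw [hδ]; field_simp
  have hK2 : 6 / K < ε / 2 := by
    rw [div_lt_iff₀ hε] at hK
    rw [div_lt_iff₀ hK0]
    linarith
  have hK3 : (5 : ℝ) / K ≤ 6 / K := by gcongr; norm_num
  have hK4 : 3 * ((2 : ℝ) / K + K * δ) = 6 / K + 3 * (K * δ) := by ring
  constructor
  · rw [poissonError, tvDist]
    simp_rw [ProbabilityTheory.poissonMeasure_real_singleton, Real.coe_toNNReal _ (rate_nonneg hr)]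
    linarith
  · rw [derangedRatio_eq hG]
    linarith

end Main

theorem theorem1p2 :
    (∀ (r : ℕ → ℕ), (∀ n, 2 ≤ r n) → (∀ n, r n ∣ 2 * n) →
      ∀ (M : (n : ℕ) → PerfectMatching (balancedMultipartite (r n) n)),
        Tendsto (fun n => poissonError (M n)) atTop (𝓝 0) ∧
        Asymptotics.IsEquivalent atTop (fun n => derangedRatio (M n))
          (fun n => Real.exp (-(rate (r n))))) ∧
    (∀ ε : ℝ, 0 < ε → ∃ N : ℕ, ∀ n : ℕ, N ≤ n → ∀ r : ℕ, 2 ≤ r → r ∣ 2 * n →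
      ∀ M : PerfectMatching (balancedMultipartite r n),
        poissonError M < ε ∧
        |derangedRatio M / Real.exp (-(rate r)) - 1| < ε) := by
  refine ⟨fun r hr hdvd M => ⟨?_, ?_⟩, fun ε hε => exists_forall_poissonError_lt hε⟩
  · refine Metric.tendsto_atTop.2 fun ε hε => ?_
    obtain ⟨N, hN⟩ := exists_forall_poissonError_lt hε
    refine ⟨N, fun n hn => ?_⟩
    rw [Real.dist_eq, sub_zero, abs_of_nonneg]
    · exact (hN n hn (r n) (hr n) (hdvd n) (M n)).1
    · exact mul_nonneg (by norm_num) (tsum_nonneg fun k => abs_nonneg _)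
  · refine (Asymptotics.isEquivalent_iff_tendsto_one
      (Eventually.of_forall fun n => (Real.exp_pos _).ne')).2 ?_
    refine Metric.tendsto_atTop.2 fun ε hε => ?_
    obtain ⟨N, hN⟩ := exists_forall_poissonError_lt hε
    exact ⟨N, fun n hn => (hN n hn (r n) (hr n) (hdvd n) (M n)).2⟩
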